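/- Write $\hat{\mathbb C}$ for the Riemann sphere. Let $\mathcal K$ be the class of non-constant functions $f:\hat{\mathbb C}\setminus B(f)\to\hat{\mathbb C}$ that are meromorphic (holomorphic as maps into $\hat{\mathbb C}$), where $B(f)\subset\hat{\mathbb C}$ is a non-empty compact countable set that is the closure of the set of isolated essential singularities of $f$. The Fatou set $F(f)$ is the largest open subset of $\hat{\mathbb C}$ on which all iterates $f^n$ are defined and form a normal family; the Julia set is $J(f)=\hat{\mathbb C}\setminus F(f)$, and a Fatou component is a connected component of $F(f)$. The set of singular values of $f$ is the closure of the union of the set of critical values of $f$ (images of critical points in $\hat{\mathbb C}\setminus B(f)$) and the set of asymptotic values of $f$ (points $a\in\hat{\mathbb C}$ such that $f(\sigma(t))\to a$ as $t\to\infty$ for some path $\sigma:[0,\infty)\to\hat{\mathbb C}\setminus B(f)$ with $\sigma(t)\to e\in B(f)$). A domain $V\subset\hat{\mathbb C}$ is multiply connected if its connectivity, the number of connected components of $\hat{\mathbb C}\setminus V$, is greater than $1$. **Proposition.** Let $f\in\mathcal K$ and let $U$ be a multiply connected Fatou component of $f$. Let $\gamma\subset U$ be a simple closed curve and let $\Delta$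 be a compact region of $\hat{\mathbb C}$ bounded by $\gamma$, that is, $\gamma$ together with one of the two components of $\hat{\mathbb C}\setminus\gamma$. Suppose that $\Delta\cap B(f)=\emptyset$, that $\Delta$ contains no singular value of $f$, and that $\operatorname{Int}(\Delta)\cap J(f)\ne\emptyset$. Then every connected component $V$ of $f^{-1}(U)$ is multiply connected. -/

import Mathlib

open Set Filter Topology

noncomputable section

/-- The Riemann sphere. -/
abbrev Sphere : Type := OnePoint ℂ

/-- The local coordinate of the sphere centred on the chart of `p`: it is `z` if `p` is finite
and `1 / z` (with value `0` at infinity) if `p` is the point at infinity. It is a coordinate on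
the complement of `∞` in the first case and on the complement of `0` in the second. -/
def Sphere.coord (p : Sphere) (q : Sphere) : ℂ :=
  open Classical in
  if p = OnePoint.infty then OnePoint.elim q (0 : ℂ) (fun z : ℂ => z⁻¹)
  else OnePoint.elim q (0 : ℂ) (fun z : ℂ => z)

/-- The inverse of the local coordinate `Sphere.coord p`. -/
def Sphere.param (p : Sphere) (w : ℂ) : Sphere :=
  open Classical in
  if p = OnePoint.infty then (if w = 0 then OnePoint.infty else ((w⁻¹ : ℂ) : Sphere))
  else (w : Sphere)

theorem Sphere.param_coord_self (p : Sphere) : Sphere.param p (Sphere.coord p p) = p := by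
  induction p using OnePoint.rec <;> simp [Sphere.param, Sphere.coord]

/-- The map `f` between spheres near `p`, read in local coordinates at `p` and at `f p`. -/
def localRep (f : Sphere → Sphere) (p : Sphere) (w : ℂ) : ℂ :=
  Sphere.coord (f p) (f (Sphere.param p w))

/-- `f` is meromorphic at `p`, that is, holomorphic near `p` as a map into the sphere. -/
def SphereMeromorphicAt (f : Sphere → Sphere) (p : Sphere) : Prop :=
  ContinuousAt f p ∧ AnalyticAt ℂ (localRep f p) (Sphere.coord p p)

/-- `e` is an isolated essential singularity of `f : Sphere ∖ B → Sphere`: `f` is defined in a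
punctured neighbourhood of `e` and has no limit in the sphere at `e`. -/
def IsIsolatedEssentialSingularity (B : Set Sphere) (f : Sphere → Sphere) (e : Sphere) : Prop :=
  (∀ᶠ z in 𝓝[≠] e, z ∉ B) ∧ ¬ ∃ w : Sphere, Tendsto f (𝓝[≠] e) (𝓝 w)

/-- The class `K`: non-constant functions, meromorphic on `Sphere ∖ B`, where `B` is a nonempty
compact countable set which is the closure of the set of isolated essential singularities.
Only the values of `f` outside `B` are meaningful: `f` stands for its restriction to `Bᶜ`, and
the notions below do not depend on the values of `f` on `B`. -/
structure IsClassK (B : Set Sphere) (f : Sphere → Sphere) : Prop where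
  nonempty : B.Nonempty
  compact : IsCompact B
  countable : B.Countable
  eq_closure : B = closure {e | IsIsolatedEssentialSingularity B f e}
  meromorphic : ∀ z ∉ B, SphereMeromorphicAt f z
  nonconstant : ¬ ∃ c : Sphere, ∀ z ∉ B, f z = c

/-- The critical values: images of the points of `Sphere ∖ B` at which the derivative of `f`,
in local coordinates, vanishes. -/
def criticalValues (B : Set Sphere) (f : Sphere → Sphere) : Set Sphere :=
  f '' {z | z ∉ B ∧ deriv (localRep f z) (Sphere.coord z z) = 0}

/-- The asymptotic values: limits of `f` along paths in `Sphere ∖ B` that tend to a point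
of `B`. -/
def asymptoticValues (B : Set Sphere) (f : Sphere → Sphere) : Set Sphere :=
  {a | ∃ e ∈ B, ∃ σ : ℝ → Sphere, ContinuousOn σ (Ici 0) ∧ (∀ t, 0 ≤ t → σ t ∉ B) ∧
    Tendsto σ atTop (𝓝 e) ∧ Tendsto (fun t => f (σ t)) atTop (𝓝 a)}

/-- The set of singular values. -/
def singularValues (B : Set Sphere) (f : Sphere → Sphere) : Set Sphere :=
  closure (criticalValues B f ∪ asymptoticValues B f)

/-- All iterates of `f` are defined (hence meromorphic) on the open set `G` and form a normal
family there: each sequence of iterates has a subsequence that converges locally uniformly on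
`G`, with respect to the uniform structure of the sphere (the one of the spherical metric; it is
the only uniform structure that induces the compact topology of the sphere). -/
def IteratesNormalOn (B : Set Sphere) (f : Sphere → Sphere) (G : Set Sphere) : Prop :=
  (∀ z ∈ G, ∀ n : ℕ, f^[n] z ∉ B) ∧
  ∀ u : ℕ → ℕ, ∃ φ : ℕ → ℕ, StrictMono φ ∧ ∃ g : Sphere → Sphere,
    letI : UniformSpace Sphere := uniformSpaceOfCompactR1
    TendstoLocallyUniformlyOn (fun k => f^[u (φ k)]) g atTop G

/-- The Fatou set: the largest open set on which the iterates are defined and normal. -/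
def fatouSet (B : Set Sphere) (f : Sphere → Sphere) : Set Sphere :=
  ⋃₀ {G | IsOpen G ∧ IteratesNormalOn B f G}

/-- The Julia set. -/
def juliaSet (B : Set Sphere) (f : Sphere → Sphere) : Set Sphere :=
  (fatouSet B f)ᶜ

/-- `C` is a connected component of the set `S`. -/
def IsComponentOf (C S : Set Sphere) : Prop :=
  ∃ z ∈ S, C = connectedComponentIn S z

/-- The connectivity of a domain of the sphere: the number of components of its complement. -/
def connectivity (V : Set Sphere) : ℕ∞ :=
  ENat.card (ConnectedComponents (Vᶜ : Set Sphere))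

/-- A multiply connected domain of the sphere. -/
def IsMultiplyConnected (V : Set Sphere) : Prop :=
  IsOpen V ∧ IsConnected V ∧ 1 < connectivity V

/-- `Δ` is a compact region of the sphere bounded by the simple closed curve `γ`: it consists of
all points that are not in a certain component (the exterior) of the complement of `γ`. As that
complement has exactly two components, both with boundary `γ`, this says that `Δ` is the closure
of the other component. On the sphere either component may be taken as the exterior. -/
def IsRegionBoundedBy (Δ : Set Sphere) (γ : Circle → Sphere) : Prop :=
  ∃ E : Set Sphere, IsComponentOf E (range γ)ᶜ ∧ Δ = Eᶜ

end

/-! Suppose `f` has a continuous section `σ` over `Δ` with `σ (γ 1) ∈ V`. Then `σ(γ)` is a connected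
subset of the preimage of `U` that meets the component `V`, so it lies in `V`. The set `σ(Δ)` is
compact, `σ(Δ ∖ γ)` is open because `σ` is a section of a local homeomorphism, and the two differ
only by points of `V`; so they cut out one and the same clopen part of `Vᶜ`. It contains `σ j` for a
Julia point `j` of the interior of `Δ`, since `f (σ j) = j ∉ U`; it misses every point of `B`, and
`B ⊆ Vᶜ`. Hence `Vᶜ` is disconnected.

The section rests on three facts.

Path lifting (`exists_lift_of_continuous`): a lift of a path of regular values can only break down
by accumulating on `B` alone. The accumulation set is connected and `B` is countable, so the lift
converges to a point of `B` and the limit value is asymptotic, hence singular.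

Monodromy (`exists_section_of_isPreconnected_compl`): path lifting gives sections over convex sets
in a chart. In a chart centred outside `Δ`, the set `Δ` becomes a plane continuum with connected
complement, which has lattice neighbourhoods without holes. Sections over single cells define a
transport between lattice points that is flat across each cell, and
`IsFlatTransport.eq_of_closed_walk` shows that closed walks have trivial holonomy. The cell sections
therefore glue. The Jordan curve theorem plays no role.

Starting point (`IsClassK.exists_mem_component_of_regular`): some point of `V` must lie over `γ 1`.
If `f(V)` were not dense in `U`, then `1 / (f - c)` for a suitable omitted value `c` would be
bounded on part of `V`, and a maximum principle that ignores the countable set `B` would force `f`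
to be locally constant. Density and a section over a small disc about a regular value then give a
point of `V` in its fibre. -/

namespace Sphere

/-! ### Charts of the sphere and countable subsets -/

theorem coord_param (p : Sphere) (w : ℂ) : coord p (param p w) = w := by
  by_cases hp : p = OnePoint.infty
  · by_cases hw : w = 0 <;> simp [coord, param, hp, hw]
  · simp [coord, param, hp]

/-- The range hypothesis is needed because `coord p` takes the default value `0` at the one point
that `param p` misses. -/
theorem param_coord {p q : Sphere} (hq : q ∈ range (param p)) : param p (coord p q) = q := by
  obtain ⟨w, rfl⟩ := hq
  rw [coord_param]

theorem mem_range_param_self (p : Sphere) : p ∈ range (param p) :=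
  ⟨_, param_coord_self p⟩

theorem tendsto_param_infty_coclosedCompact :
    Tendsto (param OnePoint.infty) (coclosedCompact ℂ) (𝓝 ((0 : ℂ) : Sphere)) := by
  have h1 : Tendsto (fun w : ℂ => ((w⁻¹ : ℂ) : Sphere)) (coclosedCompact ℂ)
      (𝓝 ((0 : ℂ) : Sphere)) := by
    refine (OnePoint.continuous_coe.tendsto 0).comp ?_
    rw [coclosedCompact_eq_cocompact, ← Metric.cobounded_eq_cocompact]
    exact tendsto_inv₀_cobounded
  refine h1.congr' ?_
  have : ∀ᶠ w : ℂ in coclosedCompact ℂ, w ≠ 0 := by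
    rw [coclosedCompact_eq_cocompact]
    exact isCompact_singleton.compl_mem_cocompact
  filter_upwards [this] with w hw
  simp [param, hw]

theorem continuous_param_infty : Continuous (param OnePoint.infty) := by
  rw [continuous_iff_continuousAt]
  intro z
  by_cases hz : z = 0
  · subst hz
    rw [continuousAt_iff_punctured_nhds]
    have h : Tendsto (fun w : ℂ => ((w⁻¹ : ℂ) : Sphere)) (𝓝[≠] 0)
        (𝓝 (OnePoint.infty : Sphere)) := by
      refine OnePoint.tendsto_coe_infty.comp ?_
      rw [coclosedCompact_eq_cocompact, ← Metric.cobounded_eq_cocompact]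
      exact tendsto_inv₀_nhdsNE_zero
    have h0 : param OnePoint.infty 0 = OnePoint.infty := by simp [param]
    rw [h0]
    refine h.congr' ?_
    filter_upwards [self_mem_nhdsWithin] with w hw
    simp [param, show w ≠ 0 from hw]
  · have h : ContinuousAt (fun w : ℂ => ((w⁻¹ : ℂ) : Sphere)) z :=
      OnePoint.continuous_coe.continuousAt.comp (continuousAt_inv₀ hz)
    refine h.congr ?_
    filter_upwards [isOpen_ne.mem_nhds hz] with w hw
    simp [param, show w ≠ 0 from hw]

/-- The inversion `z ↦ 1 / z` of the sphere. -/
noncomputable def inversion : Sphere ≃ₜ Sphere :=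
  let J : Sphere → Sphere :=
    fun q => OnePoint.elim q ((0 : ℂ) : Sphere) (param OnePoint.infty)
  have hJ : Continuous J := by
    rw [OnePoint.continuous_iff]
    exact ⟨tendsto_param_infty_coclosedCompact, continuous_param_infty⟩
  have hJJ : ∀ q, J (J q) = q := by
    intro q
    induction q using OnePoint.rec with
    | infty => simp [J, param]
    | coe z =>
      by_cases hz : z = 0
      · simp [J, param, hz]
      · simp [J, param, hz]
  { toFun := J
    invFun := J
    left_inv := hJJ
    right_inv := hJJ
    continuous_toFun := hJ
    continuous_invFun := hJ }

theorem isOpenEmbedding_param (p : Sphere) : IsOpenEmbedding (param p) := by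
  by_cases hp : p = OnePoint.infty
  · subst hp
    exact inversion.isOpenEmbedding.comp OnePoint.isOpenEmbedding_coe
  · have : param p = ((↑) : ℂ → Sphere) := by
      funext w
      simp [param, hp]
    rw [this]
    exact OnePoint.isOpenEmbedding_coe

theorem range_param_mem_nhds (p : Sphere) : range (param p) ∈ 𝓝 p :=
  (isOpenEmbedding_param p).isOpen_range.mem_nhds (mem_range_param_self p)

theorem continuousAt_coord {p q : Sphere} (hq : q ∈ range (param p)) :
    ContinuousAt (coord p) q := by
  obtain ⟨w, rfl⟩ := hq
  rw [(isOpenEmbedding_param p).continuousAt_iff.symm]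
  exact continuousAt_id.congr (Eventually.of_forall fun z => (coord_param p z).symm)

/-- Coordinate discs are connected neighbourhoods. This makes components of open sets open, which is
used for `V` and for the components of the complement of `γ`. -/
instance : LocallyConnectedSpace Sphere := by
  rw [locallyConnectedSpace_iff_connected_subsets]
  intro x U hU
  have h1 : param x ⁻¹' U ∈ 𝓝 (coord x x) := by
    refine (isOpenEmbedding_param x).continuous.continuousAt.preimage_mem_nhds ?_
    rwa [param_coord_self]
  obtain ⟨ε, hε, hball⟩ := Metric.mem_nhds_iff.1 h1
  refine ⟨param x '' Metric.ball (coord x x) ε, ?_, ?_, ?_⟩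
  · have := (isOpenEmbedding_param x).image_mem_nhds.2 (Metric.ball_mem_nhds (coord x x) hε)
    rwa [param_coord_self] at this
  · exact (convex_ball _ _).isPreconnected.image _
      (isOpenEmbedding_param x).continuous.continuousOn
  · exact image_subset_iff.2 hball

/-- The coordinate `z ↦ e + 1 / z` on the complement of the finite point `e`. -/
noncomputable def chart (e z : ℂ) : Sphere :=
  (Homeomorph.addLeft e).onePointCongr (param OnePoint.infty z)

theorem chart_zero (e : ℂ) : chart e 0 = OnePoint.infty := by
  simp [chart, param]

theorem chart_of_ne (e : ℂ) {z : ℂ} (hz : z ≠ 0) : chart e z = ((e + z⁻¹ : ℂ) : Sphere) := by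
  simp [chart, param, hz]

theorem isOpenEmbedding_chart (e : ℂ) : IsOpenEmbedding (chart e) :=
  (Homeomorph.isOpenEmbedding _).comp (isOpenEmbedding_param _)

theorem range_chart (e : ℂ) : range (chart e) = {(e : Sphere)}ᶜ := by
  ext q
  simp only [mem_range, mem_compl_iff, mem_singleton_iff]
  constructor
  · rintro ⟨z, rfl⟩
    by_cases hz : z = 0
    · simp [hz, chart_zero]
    · rw [chart_of_ne e hz, OnePoint.coe_eq_coe]
      simpa using hz
  · intro hq
    induction q using OnePoint.rec with
    | infty => exact ⟨0, chart_zero e⟩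
    | coe w =>
      have hw : w - e ≠ 0 := by
        intro h
        exact hq (by rw [sub_eq_zero.1 h])
      refine ⟨(w - e)⁻¹, ?_⟩
      rw [chart_of_ne e (inv_ne_zero hw)]
      simp

/-- Lets a locally analytic function on the sphere be read in the single chart `chart e`, where the
planar maximum principle applies. -/
theorem analyticAt_coord_chart (e z : ℂ) :
    AnalyticAt ℂ (fun ζ => coord (chart e z) (chart e ζ)) z := by
  by_cases hz : z = 0
  · subst hz
    have h : AnalyticAt ℂ (fun ζ : ℂ => ζ / (e * ζ + 1)) 0 := by
      refine AnalyticAt.div analyticAt_id (by fun_prop) (by simp)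
    refine h.congr ?_
    have h1 : ∀ᶠ ζ : ℂ in 𝓝 0, e * ζ + 1 ≠ 0 :=
      ContinuousAt.eventually_ne (by fun_prop) (by simp)
    filter_upwards [h1] with ζ hζ
    by_cases h0 : ζ = 0
    · simp [h0, chart_zero, coord]
    · rw [chart_zero, chart_of_ne e h0]
      simp only [coord, if_true, OnePoint.elim_some]
      field_simp
  · have h : AnalyticAt ℂ (fun ζ : ℂ => e + ζ⁻¹) z :=
      analyticAt_const.add (analyticAt_inv hz)
    refine h.congr ?_
    filter_upwards [isOpen_ne.mem_nhds hz] with ζ hζ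
    rw [chart_of_ne e hz, chart_of_ne e hζ]
    simp [coord]

theorem exists_coe_mem_of_isOpen {O : Set Sphere} (hO : IsOpen O) (hne : O.Nonempty) :
    ∃ e : ℂ, (e : Sphere) ∈ O := by
  obtain ⟨_, hq, e, rfl⟩ :=
    (OnePoint.denseRange_coe (X := ℂ)).inter_open_nonempty O hO hne
  exact ⟨e, hq⟩

theorem exists_coe_notMem_of_countable {B : Set Sphere} (hB : B.Countable) :
    ∃ e : ℂ, (e : Sphere) ∉ B := by
  by_contra! h
  have : (univ : Set ℂ).Countable :=
    (hB.preimage (OnePoint.coe_injective)).mono fun e _ => h e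
  exact not_countable_complex this

/-- A chart centred at a point outside `C` moves the question to the plane, where countable sets are
totally disconnected. -/
theorem subsingleton_of_isPreconnected_of_countable {C : Set Sphere} (hC : IsPreconnected C)
    (hc : C.Countable) : C.Subsingleton := by
  obtain ⟨e, he⟩ := exists_coe_notMem_of_countable hc
  have hr : C ⊆ range (chart e) := by
    rw [range_chart]
    exact fun x hx hxe => he (hxe ▸ hx)
  have hi := (isOpenEmbedding_chart e)
  have hpre : IsPreconnected (chart e ⁻¹' C) := by
    rw [← hi.isInducing.isPreconnected_image, image_preimage_eq_of_subset hr]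
    exact hC
  have hsub := (hc.preimage hi.injective).isTotallyDisconnected _ Subset.rfl hpre
  rw [← image_preimage_eq_of_subset hr]
  exact hsub.image _

theorem isConnected_compl_of_countable {B : Set Sphere} (hB : B.Countable) :
    IsConnected Bᶜ := by
  have h1 : IsConnected ((((↑) : ℂ → Sphere) ⁻¹' B)ᶜ) :=
    (hB.preimage OnePoint.coe_injective).isConnected_compl_of_one_lt_rank (by simp)
  have h2 := h1.image ((↑) : ℂ → Sphere) OnePoint.continuous_coe.continuousOn
  have h3 : ((↑) : ℂ → Sphere) '' ((((↑) : ℂ → Sphere) ⁻¹' B)ᶜ) ⊆ Bᶜ := by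
    rintro _ ⟨z, hz, rfl⟩
    exact hz
  refine h2.subset_closure h3 ?_
  intro x _
  have hd : Dense ((((↑) : ℂ → Sphere) ⁻¹' B)ᶜ) :=
    (hB.preimage OnePoint.coe_injective).dense_compl ℝ
  have := (OnePoint.denseRange_coe (X := ℂ)).dense_image OnePoint.continuous_coe hd
  exact this x

end Sphere

/-! ### Meromorphic maps in coordinates and the local homeomorphism over regular values -/

/-- `localRep` uses the coordinate at `f p`; any other coordinate that covers `f p` differs from it
by the identity or by an inversion away from its pole. -/
theorem coord_comp_analyticAt {f : Sphere → Sphere} {p a : Sphere} (hf : SphereMeromorphicAt f p)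
    (ha : f p ∈ range (Sphere.param a)) :
    AnalyticAt ℂ (fun w => Sphere.coord a (f (Sphere.param p w))) (Sphere.coord p p) := by
  by_cases h1 : f p = OnePoint.infty <;> by_cases h2 : a = OnePoint.infty
  · refine hf.2.congr (Eventually.of_forall fun w => ?_)
    simp [localRep, h1, h2]
  · exfalso
    obtain ⟨w, hw⟩ := ha
    rw [h1] at hw
    simp [Sphere.param, h2] at hw
  · have h0 : localRep f p (Sphere.coord p p) ≠ 0 := by
      obtain ⟨w, hw⟩ := ha
      rw [localRep, Sphere.param_coord_self, ← hw]
      subst h2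
      by_cases hw0 : w = 0
      · exact absurd (by rw [← hw]; simp [Sphere.param, hw0]) h1
      · simp [Sphere.param, Sphere.coord, hw0]
    refine (hf.2.inv h0).congr ?_
    have hne : ∀ᶠ w in 𝓝 (Sphere.coord p p), f (Sphere.param p w) ≠ OnePoint.infty := by
      have hc : ContinuousAt (fun w => f (Sphere.param p w)) (Sphere.coord p p) := by
        refine ContinuousAt.comp ?_ (Sphere.isOpenEmbedding_param p).continuous.continuousAt
        rw [Sphere.param_coord_self]
        exact hf.1
      refine hc.eventually_ne ?_
      rwa [Sphere.param_coord_self]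
    filter_upwards [hne] with w hw
    obtain ⟨z, hz⟩ := OnePoint.ne_infty_iff_exists.1 hw
    simp [localRep, Sphere.coord, h1, h2, ← hz]
  · refine hf.2.congr (Eventually.of_forall fun w => ?_)
    simp [localRep, Sphere.coord, h1, h2]

variable {B : Set Sphere} {f : Sphere → Sphere}

theorem isOpen_compl_inter_preimage (hB : IsCompact B) (hf : ∀ z ∉ B, SphereMeromorphicAt f z)
    {U : Set Sphere} (hU : IsOpen U) : IsOpen (Bᶜ ∩ f ⁻¹' U) := by
  have : ContinuousOn f Bᶜ := fun z hz => (hf z hz).1.continuousWithinAt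
  exact this.isOpen_inter_preimage hB.isClosed.isOpen_compl hU

/-- The points of the domain of `f` that are not mapped to singular values. -/
def regularDomain (B : Set Sphere) (f : Sphere → Sphere) : Set Sphere :=
  Bᶜ ∩ f ⁻¹' (singularValues B f)ᶜ

/-- The restriction of `f` to the points that are not mapped to singular values. -/
def regularMap (B : Set Sphere) (f : Sphere → Sphere) (z : regularDomain B f) : Sphere := f z

theorem isOpen_regularDomain (hf : IsClassK B f) : IsOpen (regularDomain B f) :=
  isOpen_compl_inter_preimage hf.compact hf.meromorphic isClosed_closure.isOpen_compl

theorem deriv_localRep_ne_zero {z : Sphere} (hz : z ∈ regularDomain B f) :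
    deriv (localRep f z) (Sphere.coord z z) ≠ 0 := fun h =>
  hz.2 (subset_closure (Or.inl ⟨z, ⟨hz.1, h⟩, rfl⟩))

theorem map_nhds_eq_of_deriv_ne_zero {z : Sphere} (hf : SphereMeromorphicAt f z)
    (hd : deriv (localRep f z) (Sphere.coord z z) ≠ 0) : map f (𝓝 z) = 𝓝 (f z) := by
  have hs : HasStrictDerivAt (localRep f z) _ (Sphere.coord z z) := hf.2.hasStrictDerivAt
  have h1 := hs.map_nhds_eq hd
  have h2 := (Sphere.isOpenEmbedding_param z).map_nhds_eq (Sphere.coord z z)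
  have h3 := (Sphere.isOpenEmbedding_param (f z)).map_nhds_eq (localRep f z (Sphere.coord z z))
  have hval : Sphere.param (f z) (localRep f z (Sphere.coord z z)) = f z := by
    rw [localRep, Sphere.param_coord_self, Sphere.param_coord_self]
  have hc : ContinuousAt (fun w => f (Sphere.param z w)) (Sphere.coord z z) := by
    refine ContinuousAt.comp ?_ (Sphere.isOpenEmbedding_param z).continuous.continuousAt
    rw [Sphere.param_coord_self]
    exact hf.1
  have heq : (fun w => f (Sphere.param z w)) =ᶠ[𝓝 (Sphere.coord z z)]
      (fun w => Sphere.param (f z) (localRep f z w)) := by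
    have : ∀ᶠ w in 𝓝 (Sphere.coord z z), f (Sphere.param z w) ∈ range (Sphere.param (f z)) := by
      refine hc.eventually_mem ?_
      rw [Sphere.param_coord_self]
      exact Sphere.range_param_mem_nhds _
    filter_upwards [this] with w hw
    rw [localRep, Sphere.param_coord hw]
  rw [Sphere.param_coord_self] at h2
  rw [hval] at h3
  rw [← h2, Filter.map_map]
  change map (fun w => f (Sphere.param z w)) _ = _
  rw [Filter.map_congr heq, ← h3, ← h1, Filter.map_map]
  rfl

theorem exists_injOn_nhds_of_deriv_ne_zero {z : Sphere} (hf : SphereMeromorphicAt f z)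
    (hd : deriv (localRep f z) (Sphere.coord z z) ≠ 0) : ∃ W ∈ 𝓝 z, InjOn f W := by
  have hs : HasStrictDerivAt (localRep f z) _ (Sphere.coord z z) := hf.2.hasStrictDerivAt
  have hs' := hs.hasStrictFDerivAt_equiv hd
  have hmem : (hs'.toOpenPartialHomeomorph _).source ∈ 𝓝 (Sphere.coord z z) :=
    (hs'.toOpenPartialHomeomorph _).open_source.mem_nhds hs'.mem_toOpenPartialHomeomorph_source
  have hinj : InjOn (localRep f z) (hs'.toOpenPartialHomeomorph _).source :=
    (hs'.toOpenPartialHomeomorph _).injOn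
  refine ⟨Sphere.param z '' (hs'.toOpenPartialHomeomorph _).source, ?_, ?_⟩
  · have := (Sphere.isOpenEmbedding_param z).image_mem_nhds.2 hmem
    rwa [Sphere.param_coord_self] at this
  · rintro _ ⟨w, hw, rfl⟩ _ ⟨w', hw', rfl⟩ h
    rw [hinj hw hw' (by rw [localRep, localRep, h])]

theorem isLocalHomeomorph_regularMap (hf : IsClassK B f) :
    IsLocalHomeomorph (regularMap B f) := by
  have hcont : Continuous (regularMap B f) := by
    rw [continuous_iff_continuousAt]
    intro z
    exact (hf.meromorphic z z.2.1).1.comp continuous_subtype_val.continuousAt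
  have hopen : IsOpenMap (regularMap B f) := by
    rw [isOpenMap_iff_nhds_le]
    intro z
    have h1 := map_nhds_eq_of_deriv_ne_zero (hf.meromorphic z z.2.1) (deriv_localRep_ne_zero z.2)
    have h2 := (isOpen_regularDomain hf).isOpenEmbedding_subtypeVal.map_nhds_eq z
    change 𝓝 (f z) ≤ map (f ∘ Subtype.val) (𝓝 z)
    rw [← Filter.map_map, h2, h1]
  rw [isLocalHomeomorph_iff_isOpenEmbedding_restrict]
  intro z
  obtain ⟨W, hW, hinj⟩ :=
    exists_injOn_nhds_of_deriv_ne_zero (hf.meromorphic z z.2.1) (deriv_localRep_ne_zero z.2)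
  obtain ⟨O, hO, hOo, hzO⟩ := mem_nhds_iff.1 hW
  have hO' : IsOpen ((↑) ⁻¹' O : Set (regularDomain B f)) := hOo.preimage continuous_subtype_val
  refine ⟨(↑) ⁻¹' O, hO'.mem_nhds hzO, ?_⟩
  refine .of_continuous_injective_isOpenMap (hcont.comp continuous_subtype_val) ?_
    (hopen.domRestrict hO')
  intro x y hxy
  exact Subtype.ext (Subtype.ext (hinj (hO x.2) (hO y.2) hxy))

/-! ### Lifting paths and convex families of paths -/

/-- If the cluster set splits into two disjoint closed pieces, separate them by disjoint open sets.
By compactness a tail of the path stays in their union, and being connected it stays in one of them,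
so the other contains no cluster point. -/
theorem isPreconnected_setOf_mapClusterPt {X : Type*} [TopologicalSpace X] [CompactSpace X]
    [T2Space X] {t : ℝ} {σ : ℝ → X} {a : ℝ} (ha : a < t) (hσ : ContinuousOn σ (Ico a t)) :
    IsPreconnected {x | MapClusterPt x (𝓝[<] t) σ} := by
  have hclosed : IsClosed {x | MapClusterPt x (𝓝[<] t) σ} :=
    isClosed_setOfPred_clusterPt
  rw [isPreconnected_iff_subset_of_fully_disjoint_closed hclosed]
  intro u v hu hv huv hd
  obtain ⟨U, V, hU, hV, huU, hvV, hUV⟩ := normal_separation hu hv hd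
  have hev : ∀ᶠ s in 𝓝[<] t, σ s ∈ U ∪ V := by
    by_contra hcon
    have hfr : ∃ᶠ s in 𝓝[<] t, σ s ∈ (U ∪ V)ᶜ := not_eventually.1 hcon
    obtain ⟨x, hx, hxc⟩ := (hU.union hV).isClosed_compl.isCompact.exists_mapClusterPt_of_frequently
      hfr
    exact hx ((huv hxc).imp (fun h => huU h) fun h => hvV h)
  obtain ⟨b, hb, hbs⟩ := (mem_nhdsLT_iff_exists_Ioo_subset' ha).1
    (inter_mem hev (Ico_mem_nhdsLT ha))
  have hpre : IsPreconnected (σ '' Ioo b t) :=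
    isPreconnected_Ioo.image σ (hσ.mono fun s hs => (hbs hs).2)
  have hsub : σ '' Ioo b t ⊆ U ∪ V := image_subset_iff.2 fun s hs => (hbs hs).1
  have key : ∀ P Q : Set X, IsOpen Q → Disjoint P Q → σ '' Ioo b t ⊆ P →
      ∀ x, MapClusterPt x (𝓝[<] t) σ → x ∉ Q := by
    intro P Q hQ hPQ hP x hx hxQ
    have h1 := (hx.frequently (hQ.mem_nhds hxQ)).and_eventually (Ioo_mem_nhdsLT hb)
    obtain ⟨s, hs, hs'⟩ := h1.exists
    exact disjoint_left.1 hPQ (hP ⟨s, hs', rfl⟩) hs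
  rcases hpre.subset_or_subset hU hV hUV hsub with h | h
  · left
    intro x hx
    exact (huv hx).resolve_right fun hxv => key U V hV hUV h x hx (hvV hxv)
  · right
    intro x hx
    exact (huv hx).resolve_left fun hxu => key V U hU hUV.symm h x hx (huU hxu)

/-- A lift of the path `α` on `[0, t]` with initial point `y₀`. -/
def IsLiftUpTo {Y X : Type*} [TopologicalSpace Y] (p : Y → X) (α : ℝ → X) (y₀ : Y) (t : ℝ)
    (σ : ℝ → Y) : Prop :=
  ContinuousOn σ (Icc 0 t) ∧ σ 0 = y₀ ∧ ∀ s ∈ Icc 0 t, p (σ s) = α s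

section Lift

variable {Y X : Type*} [TopologicalSpace Y] [TopologicalSpace X] {p : Y → X} {α : ℝ → X} {y₀ : Y}

omit [TopologicalSpace X] in
theorem IsLiftUpTo.mono {s t : ℝ} {σ : ℝ → Y} (h : IsLiftUpTo p α y₀ t σ) (hst : s ≤ t) :
    IsLiftUpTo p α y₀ s σ :=
  ⟨h.1.mono (Icc_subset_Icc_right hst), h.2.1, fun r hr => h.2.2 r ⟨hr.1, hr.2.trans hst⟩⟩

theorem IsLiftUpTo.eqOn [T2Space Y] (hp : IsLocalHomeomorph p) {t : ℝ} {σ τ : ℝ → Y} (ht : 0 ≤ t)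
    (hσ : IsLiftUpTo p α y₀ t σ) (hτ : IsLiftUpTo p α y₀ t τ) : EqOn σ τ (Icc 0 t) :=
  (T2Space.isSeparatedMap p).eqOn_of_comp_eqOn hp.isLocallyInjective isPreconnected_Icc hσ.1 hτ.1
    (fun s hs => (hσ.2.2 s hs).trans (hτ.2.2 s hs).symm) (left_mem_Icc.2 ht)
    (hσ.2.1.trans hτ.2.1.symm)

theorem IsLiftUpTo.extend {a b : ℝ} {σ : ℝ → Y} (ha : 0 ≤ a) (hα : Continuous α)
    (h : IsLiftUpTo p α y₀ a σ) (q : OpenPartialHomeomorph Y X) (hq : EqOn p q q.source)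
    (hsrc : σ a ∈ q.source) (htgt : ∀ s ∈ Icc a b, α s ∈ q.target) :
    ∃ τ, IsLiftUpTo p α y₀ b τ := by
  classical
  refine ⟨fun s => if s ≤ a then σ s else q.symm (α s), ?_, ?_, ?_⟩
  · refine ContinuousOn.if (p := fun s => s ≤ a) ?_ ?_ ?_
    · intro s hs
      have hsa : s = a := frontier_le_subset_eq continuous_id continuous_const hs.2
      subst hsa
      rw [← h.2.2 s ⟨ha, le_rfl⟩, hq hsrc, q.left_inv hsrc]
    · refine h.1.mono fun s hs => ⟨hs.1.1, ?_⟩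
      exact (closure_le_eq continuous_id continuous_const).subset hs.2
    · refine q.continuousOn_symm.comp hα.continuousOn fun s hs => htgt s ⟨?_, hs.1.2⟩
      have h2 := hs.2
      simp only [not_le] at h2
      exact closure_lt_subset_le continuous_const continuous_id h2
  · simp [ha, h.2.1]
  · intro s hs
    by_cases hsa : s ≤ a
    · simp [hsa, h.2.2 s ⟨hs.1, hsa⟩]
    · have ht := htgt s ⟨(not_le.1 hsa).le, hs.2⟩
      simp only [hsa, if_false]
      rw [hq (q.map_target ht), q.right_inv ht]

end Lift

/-- Either the lift on `[0, t)` has a cluster point outside `B`, which is a regular point over `α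
t`, and a local inverse of `f` there continues the lift past a nearby time; or all cluster points
lie in `B`, the lift converges to one of them, and `α t` would be an asymptotic value. -/
theorem IsLiftUpTo.of_lt (hf : IsClassK B f) {α : ℝ → Sphere} (hα : Continuous α)
    (hS : ∀ t, α t ∉ singularValues B f) {y₀ : regularDomain B f} {t : ℝ} (ht : 0 < t)
    (h : ∀ s, 0 ≤ s → s < t → ∃ σ, IsLiftUpTo (regularMap B f) α y₀ s σ) :
    ∃ σ, IsLiftUpTo (regularMap B f) α y₀ t σ := by
  have hp := isLocalHomeomorph_regularMap hf
  have : Nonempty (regularDomain B f) := ⟨y₀⟩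
  -- The lifts `L s` on `[0, s]` agree by uniqueness, so their diagonal `s ↦ L s s` lifts `α` on all
  -- of `[0, t)`.
  choose! L hL using h
  set σ : ℝ → regularDomain B f := fun s => L s s with hσ
  have hLL : ∀ s, 0 ≤ s → s < t → EqOn σ (L s) (Icc 0 s) := by
    intro s hs hst r hr
    exact IsLiftUpTo.eqOn hp hr.1 (hL r hr.1 (hr.2.trans_lt hst)) ((hL s hs hst).mono hr.2)
      (right_mem_Icc.2 hr.1)
  have hσL : ∀ s, 0 ≤ s → s < t → IsLiftUpTo (regularMap B f) α y₀ s σ := by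
    intro s hs hst
    refine ⟨(hL s hs hst).1.congr (hLL s hs hst), ?_, ?_⟩
    · rw [hLL s hs hst (left_mem_Icc.2 hs)]
      exact (hL s hs hst).2.1
    · intro r hr
      rw [hLL s hs hst hr]
      exact (hL s hs hst).2.2 r hr
  have hσc : ContinuousOn σ (Ico 0 t) := by
    intro s hs
    obtain ⟨r, hsr, hrt⟩ := exists_between hs.2
    have h1 := (hσL r (hs.1.trans hsr.le) hrt).1 s ⟨hs.1, hsr.le⟩
    refine h1.mono_of_mem_nhdsWithin ?_
    rw [mem_nhdsWithin]
    exact ⟨Iio r, isOpen_Iio, hsr, fun x hx => ⟨hx.2.1, hx.1.le⟩⟩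
  set τ : ℝ → Sphere := fun s => σ s with hτ
  have hτc : ContinuousOn τ (Ico 0 t) := continuous_subtype_val.comp_continuousOn hσc
  have hfτ : ∀ s ∈ Ico 0 t, f (τ s) = α s := fun s hs =>
    (hσL s hs.1 hs.2).2.2 s (right_mem_Icc.2 hs.1)
  have hlim : Tendsto (fun s => f (τ s)) (𝓝[<] t) (𝓝 (α t)) := by
    refine ((hα.tendsto t).mono_left nhdsWithin_le_nhds).congr' ?_
    filter_upwards [Ico_mem_nhdsLT ht] with s hs
    exact (hfτ s hs).symm
  by_cases hcl : ∃ z, z ∉ B ∧ MapClusterPt z (𝓝[<] t) τ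
  · obtain ⟨z, hzB, hz⟩ := hcl
    have hfz : f z = α t := by
      have h1 : MapClusterPt (f z) (𝓝[<] t) (f ∘ τ) := hz.continuousAt_comp (hf.meromorphic z hzB).1
      have h2 : ClusterPt (f z) (𝓝 (α t)) := h1.clusterPt.mono hlim
      exact eq_of_nhds_neBot h2
    have hzY : z ∈ regularDomain B f := ⟨hzB, by rw [mem_preimage, hfz]; exact hS t⟩
    obtain ⟨q, hzq, hpq⟩ := hp ⟨z, hzY⟩
    have hsrc : Subtype.val '' q.source ∈ 𝓝 z :=
      ((isOpen_regularDomain hf).isOpenMap_subtype_val _ q.open_source).mem_nhds ⟨_, hzq, rfl⟩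
    have htgt : q.target ∈ 𝓝 (α t) := by
      refine q.open_target.mem_nhds ?_
      have := q.map_source hzq
      rw [← hpq] at this
      rwa [← hfz]
    obtain ⟨ε, hε, hball⟩ := Metric.mem_nhds_iff.1 (hα.continuousAt.preimage_mem_nhds htgt)
    have hlt : max 0 (t - ε) < t := max_lt ht (by linarith)
    obtain ⟨a, ha, ha'⟩ := ((hz.frequently hsrc).and_eventually (Ioo_mem_nhdsLT hlt)).exists
    have ha0 : 0 ≤ a := (le_max_left _ _).trans ha'.1.le
    have haε : t - ε < a := (le_max_right _ _).trans_lt ha'.1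
    refine (hσL a ha0 ha'.2).extend ha0 hα q (fun x _ => congrFun hpq x) ?_ ?_ (b := t)
    · obtain ⟨y, hy, hya⟩ := ha
      rwa [← Subtype.ext hya]
    · intro s hs
      refine hball ?_
      rw [Metric.mem_ball, Real.dist_eq, abs_lt]
      constructor <;> linarith [hs.1, hs.2]
  · exfalso
    push Not at hcl
    have hsub : {x | MapClusterPt x (𝓝[<] t) τ} ⊆ B := fun x hx => by
      by_contra hxB
      exact hcl x hxB hx
    have hss := Sphere.subsingleton_of_isPreconnected_of_countable
      (isPreconnected_setOf_mapClusterPt ht hτc) (hf.countable.mono hsub)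
    obtain ⟨e, -, he⟩ := isCompact_univ.exists_mapClusterPt (f := 𝓝[<] t) (u := τ) (by simp)
    have htend : Tendsto τ (𝓝[<] t) (𝓝 e) :=
      tendsto_nhds_of_unique_mapClusterPt fun x hx => hss hx he
    -- Asymptotic values are defined by paths on `[0, ∞)`; `r ↦ t * r / (1 + r)` reparametrizes `[0,
    -- t)`.
    have hmem : ∀ r : ℝ, 0 ≤ r → t * r / (1 + r) ∈ Ico 0 t := by
      intro r hr
      refine ⟨by positivity, ?_⟩
      rw [div_lt_iff₀ (by linarith)]
      nlinarith
    have hr : Tendsto (fun r : ℝ => t * r / (1 + r)) atTop (𝓝[<] t) := by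
      refine tendsto_nhdsWithin_iff.2 ⟨?_, ?_⟩
      · have h1 : Tendsto (fun r : ℝ => t - t / (1 + r)) atTop (𝓝 (t - 0)) :=
          tendsto_const_nhds.sub
            (tendsto_const_nhds.div_atTop (tendsto_atTop_add_const_left _ _ tendsto_id))
        rw [sub_zero] at h1
        refine h1.congr' ?_
        filter_upwards [eventually_ge_atTop 0] with r hr
        field_simp
        ring
      · filter_upwards [eventually_ge_atTop 0] with r hr
        exact (hmem r hr).2
    refine hS t (subset_closure (Or.inr ⟨e, hsub he, fun r => τ (t * r / (1 + r)), ?_, ?_, ?_, ?_⟩))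
    · refine hτc.comp ?_ fun r hr => hmem r hr
      refine ContinuousOn.div (by fun_prop) (by fun_prop) fun r hr => ?_
      have : (0 : ℝ) ≤ r := hr
      linarith
    · intro r hr
      exact (σ _).2.1
    · exact htend.comp hr
    · exact hlim.comp hr

theorem exists_lift_of_continuous (hf : IsClassK B f) {α : ℝ → Sphere} (hα : Continuous α)
    (hS : ∀ t, α t ∉ singularValues B f) {y₀ : regularDomain B f}
    (h0 : regularMap B f y₀ = α 0) :
    ∃ σ, IsLiftUpTo (regularMap B f) α y₀ 1 σ := by
  have hp := isLocalHomeomorph_regularMap hf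
  set T : Set ℝ := {t | ∃ σ, IsLiftUpTo (regularMap B f) α y₀ t σ} with hT
  have hT0 : (0 : ℝ) ∈ T := by
    refine ⟨fun _ => y₀, continuousOn_const, rfl, fun s hs => ?_⟩
    have : s = 0 := le_antisymm hs.2 hs.1
    rw [this, h0]
  have hclosed : IsClosed (T ∩ Icc 0 1) := by
    refine isClosed_of_closure_subset fun t ht => ?_
    have ht01 : t ∈ Icc (0 : ℝ) 1 :=
      isClosed_Icc.closure_subset_iff.2 inter_subset_right ht
    refine ⟨?_, ht01⟩
    rcases ht01.1.eq_or_lt with h | h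
    · rwa [← h]
    refine IsLiftUpTo.of_lt hf hα hS h fun s _ hst => ?_
    obtain ⟨r, hr, hrT⟩ := mem_closure_iff_nhds.1 ht _ (Ioi_mem_nhds hst)
    obtain ⟨σ, hσ⟩ := hrT.1
    exact ⟨σ, hσ.mono (le_of_lt hr)⟩
  refine hclosed.Icc_subset_of_forall_exists_gt hT0 ?_ (right_mem_Icc.2 zero_le_one)
  rintro t ⟨⟨σ, hσ⟩, ht⟩ b hb
  obtain ⟨q, hq, hpq⟩ := hp (σ t)
  have htgt : q.target ∈ 𝓝 (α t) := by
    refine q.open_target.mem_nhds ?_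
    rw [← hσ.2.2 t ⟨ht.1, le_rfl⟩, hpq]
    exact q.map_source hq
  obtain ⟨ε, hε, hball⟩ := Metric.mem_nhds_iff.1 (hα.continuousAt.preimage_mem_nhds htgt)
  refine ⟨min b (t + ε / 2), ?_, lt_min hb (by linarith), min_le_left _ _⟩
  refine hσ.extend ht.1 hα q (fun x _ => congrFun hpq x) hq fun s hs => hball ?_
  have := hs.2.trans (min_le_right _ _)
  rw [Metric.mem_ball, Real.dist_eq, abs_lt]
  constructor <;> linarith [hs.1]

/-- Over a convex set of regular values, in a coordinate of the sphere, `f` has a continuous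
section through each given point. -/
theorem exists_section_of_convex (hf : IsClassK B f) {ψ : ℂ → Sphere} (hψ : Continuous ψ)
    {D : Set ℂ} (hD : Convex ℝ D) (hDS : ∀ w ∈ D, ψ w ∉ singularValues B f)
    {w₀ : ℂ} (hw₀ : w₀ ∈ D) {y₀ : regularDomain B f} (h0 : regularMap B f y₀ = ψ w₀) :
    ∃ s : ℂ → regularDomain B f, ContinuousOn s D ∧ s w₀ = y₀ ∧
      ∀ w ∈ D, regularMap B f (s w) = ψ w := by
  have hp := isLocalHomeomorph_regularMap hf
  -- Clamping the time to `[0, 1]` extends each segment from `w₀` to a path on the whole line that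
  -- stays in `D`.
  set c : ℝ → ℝ := fun t => max 0 (min 1 t) with hc
  have hcc : Continuous c := by fun_prop
  have hc01 : ∀ t, 0 ≤ c t ∧ c t ≤ 1 := fun t =>
    ⟨le_max_left _ _, max_le zero_le_one (min_le_left _ _)⟩
  have hcI : ∀ t ∈ Icc (0 : ℝ) 1, c t = t := fun t ht => by
    rw [hc]; simp [ht.1, ht.2]
  have hline : ∀ w ∈ D, ∀ t : ℝ, w₀ + c t • (w - w₀) ∈ D := fun w hw t =>
    hD.add_smul_sub_mem hw₀ hw (hc01 t)
  have hlift : ∀ w : D, ∃ σ, IsLiftUpTo (regularMap B f)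
      (fun t : ℝ => ψ (w₀ + c t • ((w : ℂ) - w₀))) y₀ 1 σ := by
    intro w
    refine exists_lift_of_continuous hf (hψ.comp (by fun_prop)) (fun t => hDS _ (hline w w.2 t)) ?_
    simp [h0, hcI 0 (by simp)]
  choose σ hσ using hlift
  let F : C(unitInterval × D, Sphere) :=
    ⟨fun x => ψ (w₀ + (x.1 : ℝ) • ((x.2 : ℂ) - w₀)), hψ.comp (by fun_prop)⟩
  -- Lifts of single segments depend continuously on their endpoint, by continuity of lifts of
  -- homotopies through a separated local homeomorphism.
  have hg : Continuous (fun x : unitInterval × D => σ x.2 x.1) := by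
    refine hp.continuous_lift (T2Space.isSeparatedMap _) F ?_ ?_ ?_
    · funext x
      have := (hσ x.2).2.2 x.1 x.1.2
      simp only [hcI _ x.1.2] at this
      exact this
    · have : (fun w : D => σ w ((0 : unitInterval) : ℝ)) = fun _ => y₀ := by
        funext w
        exact (hσ w).2.1
      change Continuous (fun w : D => σ w ((0 : unitInterval) : ℝ))
      rw [this]
      exact continuous_const
    · intro w
      exact (continuousOn_iff_continuous_domRestrict.1 (hσ w).1)
  classical
  refine ⟨fun w => if hw : w ∈ D then σ ⟨w, hw⟩ 1 else y₀, ?_, ?_, ?_⟩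
  · rw [continuousOn_iff_continuous_domRestrict]
    have h1 : Continuous (fun w : D => σ w ((1 : unitInterval) : ℝ)) :=
      hg.comp (Continuous.prodMk continuous_const continuous_id)
    refine h1.congr fun w => ?_
    simp
  · simp only [hw₀, dif_pos]
    have hconst : IsLiftUpTo (regularMap B f)
        (fun t : ℝ => ψ (w₀ + c t • (((⟨w₀, hw₀⟩ : D) : ℂ) - w₀))) y₀ 1 (fun _ => y₀) :=
      ⟨continuousOn_const, rfl, fun s _ => by simp [h0]⟩
    exact IsLiftUpTo.eqOn hp zero_le_one (hσ ⟨w₀, hw₀⟩) hconst (right_mem_Icc.2 zero_le_one)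
  · intro w hw
    simp only [hw, dif_pos]
    rw [(hσ ⟨w, hw⟩).2.2 1 (by simp)]
    simp [hcI 1 (by simp)]

/-! ### Trivial holonomy of flat transports on lattice regions without holes -/

/-- The lattice point `u` is a corner of the lattice cell with lower left corner `c`. -/
def IsCellCorner (c u : ℤ × ℤ) : Prop :=
  c.1 ≤ u.1 ∧ u.1 ≤ c.1 + 1 ∧ c.2 ≤ u.2 ∧ u.2 ≤ c.2 + 1

/-- Neighbours in the lattice `ℤ × ℤ`. -/
def LatticeAdj (u w : ℤ × ℤ) : Prop :=
  (u.1 = w.1 ∧ (w.2 = u.2 + 1 ∨ u.2 = w.2 + 1)) ∨ (u.2 = w.2 ∧ (w.1 = u.1 + 1 ∨ u.1 = w.1 + 1))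

/-- `u` and `w` are joined by an edge of a cell in `P`. -/
def IsCellEdge (P : Set (ℤ × ℤ)) (u w : ℤ × ℤ) : Prop :=
  LatticeAdj u w ∧ ∃ c ∈ P, IsCellCorner c u ∧ IsCellCorner c w

/-- The cells that can be reached from the half-plane at height `R` through neighbouring cells
outside `M`. -/
inductive IsOuterCell (M : Set (ℤ × ℤ)) (R : ℤ) : ℤ × ℤ → Prop
  | top (c : ℤ × ℤ) (h : R ≤ c.2) : IsOuterCell M R c
  | step (c c' : ℤ × ℤ) (h : IsOuterCell M R c) (hadj : LatticeAdj c c') (hM : c' ∉ M) :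
      IsOuterCell M R c'

/-- The signed crossing of the lattice edge from `u` to `w` with the vertical ray upward from the
cell `c`. -/
def rayCrossing (c u w : ℤ × ℤ) : ℤ :=
  if c.2 < u.2 ∧ c.2 < w.2 then (if c.1 < w.1 then 1 else 0) - (if c.1 < u.1 then 1 else 0) else 0

/-- The two rays differ only in crossing the edge shared by the two cells. That edge bounds no other
cell, so it is not an edge of a cell in `P`. -/
theorem rayCrossing_above {P : Set (ℤ × ℤ)} {a b : ℤ} {u w : ℤ × ℤ} (h : IsCellEdge P u w)
    (h1 : (a, b) ∉ P) (h2 : (a, b + 1) ∉ P) :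
    rayCrossing (a, b) u w = rayCrossing (a, b + 1) u w := by
  obtain ⟨hadj, c, hc, hcu, hcw⟩ := h
  have hc1 : ¬ (c.1 = a ∧ c.2 = b) := fun h => h1 (by rwa [← h.1, ← h.2])
  have hc2 : ¬ (c.1 = a ∧ c.2 = b + 1) := fun h => h2 (by rwa [← h.1, ← h.2])
  simp only [LatticeAdj, IsCellCorner] at hadj hcu hcw
  simp only [rayCrossing]
  split_ifs <;> omega

/-- Between horizontally adjacent rays the difference is a coboundary, namely the change of the
indicator of the half-line `x = a + 1`, `y > b`, so it telescopes to zero along a closed walk. The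
shared vertical edge would break this formula, and it is excluded since neither cell lies in `P`. -/
theorem rayCrossing_right {P : Set (ℤ × ℤ)} {a b : ℤ} {u w : ℤ × ℤ} (h : IsCellEdge P u w)
    (h1 : (a, b) ∉ P) (h2 : (a + 1, b) ∉ P) :
    rayCrossing (a, b) u w - rayCrossing (a + 1, b) u w =
      (if w.1 = a + 1 ∧ b < w.2 then 1 else 0) - (if u.1 = a + 1 ∧ b < u.2 then 1 else 0) := by
  obtain ⟨hadj, c, hc, hcu, hcw⟩ := h
  have hc1 : ¬ (c.1 = a ∧ c.2 = b) := fun h => h1 (by rwa [← h.1, ← h.2])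
  have hc2 : ¬ (c.1 = a + 1 ∧ c.2 = b) := fun h => h2 (by rwa [← h.1, ← h.2])
  simp only [LatticeAdj, IsCellCorner] at hadj hcu hcw
  simp only [rayCrossing]
  split_ifs <;> omega

/-- The number of crossings of a lattice walk with the vertical ray upward from a cell. -/
def crossingNumber (v : ℕ → ℤ × ℤ) (n : ℕ) (c : ℤ × ℤ) : ℤ :=
  ∑ i ∈ Finset.range n, rayCrossing c (v i) (v (i + 1))

theorem crossingNumber_eq_of_adj {P : Set (ℤ × ℤ)} {v : ℕ → ℤ × ℤ} {n : ℕ}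
    (hv : ∀ i < n, IsCellEdge P (v i) (v (i + 1))) (hcl : v n = v 0) {c c' : ℤ × ℤ}
    (hadj : LatticeAdj c c') (hc : c ∉ P) (hc' : c' ∉ P) :
    crossingNumber v n c = crossingNumber v n c' := by
  have habove : ∀ a b : ℤ, (a, b) ∉ P → (a, b + 1) ∉ P →
      crossingNumber v n (a, b) = crossingNumber v n (a, b + 1) := fun a b h1 h2 =>
    Finset.sum_congr rfl fun i hi => rayCrossing_above (hv i (Finset.mem_range.1 hi)) h1 h2
  have hright : ∀ a b : ℤ, (a, b) ∉ P → (a + 1, b) ∉ P →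
      crossingNumber v n (a, b) = crossingNumber v n (a + 1, b) := by
    intro a b h1 h2
    rw [← sub_eq_zero, crossingNumber, crossingNumber, ← Finset.sum_sub_distrib,
      Finset.sum_congr rfl fun i hi => rayCrossing_right (hv i (Finset.mem_range.1 hi)) h1 h2,
      Finset.sum_range_sub (fun i => if (v i).1 = a + 1 ∧ b < (v i).2 then (1 : ℤ) else 0), hcl,
      sub_self]
  obtain ⟨a, b⟩ := c
  obtain ⟨a', b'⟩ := c'
  rcases hadj with ⟨h1, h2 | h2⟩ | ⟨h1, h2 | h2⟩ <;> simp only at h1 h2 <;> subst h1 h2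
  · exact habove _ _ hc hc'
  · exact (habove _ _ hc' hc).symm
  · exact hright _ _ hc hc'
  · exact (hright _ _ hc' hc).symm

/-- The crossing number is constant along a chain of cells outside `P`, and an outer cell is joined
by such a chain to a height above which the walk has no edge. -/
theorem IsOuterCell.crossingNumber_eq_zero {M : Set (ℤ × ℤ)} {R : ℤ} {v : ℕ → ℤ × ℤ} {n : ℕ}
    (hv : ∀ i < n, IsCellEdge {c | ¬ IsOuterCell M R c} (v i) (v (i + 1))) (hcl : v n = v 0)
    {c : ℤ × ℤ} (hc : IsOuterCell M R c) : crossingNumber v n c = 0 := by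
  induction hc with
  | top c h =>
    refine Finset.sum_eq_zero fun i hi => ?_
    obtain ⟨-, d, hd, hdu, -⟩ := hv i (Finset.mem_range.1 hi)
    have hdR : d.2 < R := not_le.1 fun hle => hd (.top d hle)
    simp only [IsCellCorner] at hdu
    rw [rayCrossing, if_neg (by omega)]
  | step c c' h hadj hM ih =>
    rw [← ih]
    exact (crossingNumber_eq_of_adj hv hcl hadj (not_not_intro h)
      (not_not_intro (.step c c' h hadj hM))).symm

/-- A transport of points of `X` along the edges of the cells in `P`, flat across each cell. It is
enough to ask for flatness at the upper left corners of the cells. -/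
structure IsFlatTransport {X : Type*} (π : X → ℤ × ℤ) (P : Set (ℤ × ℤ)) (T : X → X → Prop) :
    Prop where
  edge : ∀ {x y}, T x y → IsCellEdge P (π x) (π y)
  symm : ∀ {x y}, T x y → T y x
  unique : ∀ {x y z}, T x y → T x z → π y = π z → y = z
  lift : ∀ {x y z}, T x y → π z = π x → ∃ w, π w = π y ∧ T z w
  flat : ∀ {a b : ℤ} {x y z}, (a, b) ∈ P → π x = (a, b) → π y = (a, b + 1) →
    π z = (a + 1, b + 1) → T x y → T y z → ∃ w, π w = (a + 1, b) ∧ T x w ∧ T w z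

namespace IsFlatTransport

variable {X : Type*} {π : X → ℤ × ℤ} {T : X → X → Prop} {P : Set (ℤ × ℤ)}

/-- A repeated base point splits the walk into a closed subwalk and the remaining closed walk, both
shorter. By `ih` the first closes up, so it can be cut out, and then the second closes up, contrary
to `hne`. -/
theorem ne_of_minimal {n : ℕ} {L : ℤ} {x : ℕ → X}
    (ih : ∀ k < n, ∀ y : ℕ → X, (∀ i < k, T (y i) (y (i + 1))) → (∀ i ≤ k, L ≤ (π (y i)).2) →
      π (y k) = π (y 0) → y k = y 0)
    (hx : ∀ i < n, T (x i) (x (i + 1))) (hL : ∀ i ≤ n, L ≤ (π (x i)).2)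
    (hcl : π (x n) = π (x 0)) (hne : x n ≠ x 0) {i j : ℕ} (hij : i < j) (hj : j ≤ n)
    (h0 : 0 < i ∨ j < n) : π (x i) ≠ π (x j) := by
  intro h
  have h1 : x j = x i := by
    have := ih (j - i) (by omega) (fun k => x (i + k)) (fun k hk => hx _ (by omega))
      (fun k hk => hL _ (by omega))
    simp only [add_zero, Nat.add_sub_cancel' hij.le] at this
    exact this h.symm
  have h2 := ih (n - (j - i)) (by omega) (fun k => if k ≤ i then x k else x (k + (j - i))) ?_ ?_ ?_
  · refine hne ?_
    simp only [Nat.zero_le, if_true] at h2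
    split_ifs at h2 with h3
    · have : n - (j - i) = i := by omega
      have hn : n = j := by omega
      rw [this] at h2
      rw [hn, h1, h2]
    · rwa [Nat.sub_add_cancel (by omega)] at h2
  · intro k hk
    rcases lt_trichotomy k i with hki | hki | hki
    · simp only [hki.le, if_true, show k + 1 ≤ i from hki]
      exact hx _ (by omega)
    · subst hki
      simp only [le_refl, if_true, show ¬ (k + 1 ≤ k) by omega, if_false]
      rw [← h1]
      have := hx j (by omega)
      rwa [show k + 1 + (j - k) = j + 1 by omega]
    · simp only [show ¬ k ≤ i by omega, show ¬ (k + 1 ≤ i) by omega, if_false]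
      have := hx (k + (j - i)) (by omega)
      rwa [show k + 1 + (j - i) = k + (j - i) + 1 by omega]
  · intro k hk
    split_ifs
    · exact hL _ (by omega)
    · exact hL _ (by omega)
  · simp only [Nat.zero_le, if_true]
    split_ifs with h3
    · have : n - (j - i) = i := by omega
      have hn : n = j := by omega
      rw [this, ← h1, ← hn, hcl]
    · rw [Nat.sub_add_cancel (by omega), hcl]

/-- A nontrivial closed walk of minimal length can be lowered at a vertex that is leftmost among
its highest vertices. -/
theorem exists_lower {M : Set (ℤ × ℤ)} {R : ℤ} (hT : IsFlatTransport π {c | ¬ IsOuterCell M R c} T)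
    {n : ℕ} {x : ℕ → X} (hx : ∀ i < n, T (x i) (x (i + 1))) (hcl : π (x n) = π (x 0))
    (hsimple : ∀ i j, i < j → j ≤ n → 0 < i ∨ j < n → π (x i) ≠ π (x j)) (hne : x n ≠ x 0)
    {m : ℕ} (hm0 : 0 < m) (hmn : m < n)
    (hmax : ∀ i ≤ n, (π (x i)).2 < (π (x m)).2 ∨
      ((π (x i)).2 = (π (x m)).2 ∧ (π (x m)).1 ≤ (π (x i)).1)) :
    ∃ y, (π y).2 + 1 = (π (x m)).2 ∧ T (x (m - 1)) y ∧ T y (x (m + 1)) ∧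
      ((π y).2 = (π (x (m - 1))).2 ∨ (π y).2 = (π (x (m + 1))).2) := by
  have hxm : T (x (m - 1)) (x m) := by
    have := hx (m - 1) (by omega)
    rwa [Nat.sub_add_cancel hm0] at this
  have hxm' : T (x m) (x (m + 1)) := hx m hmn
  -- For a walk of two steps that turns back at `x m`, uniqueness of transport already closes the
  -- walk; otherwise simplicity applies.
  have huw : π (x (m - 1)) ≠ π (x (m + 1)) := by
    by_cases h : m - 1 = 0 ∧ m + 1 = n
    · intro h'
      have := hT.unique (hT.symm hxm) hxm' h'
      rw [h.1, h.2] at this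
      exact hne this.symm
    · exact hsimple _ _ (by omega) (by omega) (by omega)
  obtain ⟨a, b, hv⟩ : ∃ a b : ℤ, π (x m) = (a, b + 1) := ⟨(π (x m)).1, (π (x m)).2 - 1, by simp⟩
  have hu := (hT.edge hxm).1
  have hw := (hT.edge hxm').1
  have hmu := hmax (m - 1) (by omega)
  have hmw := hmax (m + 1) (by omega)
  simp only [hv, LatticeAdj] at hu hw hmu hmw
  have hnb : ∀ u : ℤ × ℤ, (u.1 = a ∧ u.2 = b) → u = (a, b) := fun u h => Prod.ext h.1 h.2
  have hnb' : ∀ u : ℤ × ℤ, (u.1 = a + 1 ∧ u.2 = b + 1) → u = (a + 1, b + 1) :=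
    fun u h => Prod.ext h.1 h.2
  have hor : ∀ u : ℤ × ℤ, (u.1 = a ∧ u.2 = b) ∨ (u.1 = a + 1 ∧ u.2 = b + 1) →
      u = (a, b) ∨ u = (a + 1, b + 1) := fun u h => h.imp (hnb u) (hnb' u)
  have hu' := hor (π (x (m - 1))) (by omega)
  have hw' := hor (π (x (m + 1))) (by omega)
  -- No vertex is higher than `b + 1`, so the ray above `(a, b)` can only meet the edge from `(a, b
  -- + 1)` to `(a + 1, b + 1)`. As `x m` is the only vertex over `(a, b + 1)`, this edge is
  -- traversed exactly once; the crossing number is then nonzero and `(a, b)` is not an outer cell.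
  -- Flatness across it replaces the corner `(a, b + 1)` by `(a + 1, b)`.
  have hcross : ∀ i < n, rayCrossing (a, b) (π (x i)) (π (x (i + 1))) ≠ 0 →
      (π (x i) = (a, b + 1) ∧ π (x (i + 1)) = (a + 1, b + 1)) ∨
      (π (x i) = (a + 1, b + 1) ∧ π (x (i + 1)) = (a, b + 1)) := by
    intro i hi hne0
    have h1 := (hT.edge (hx i hi)).1
    have h2 := hmax i hi.le
    have h3 := hmax (i + 1) hi
    simp only [hv, LatticeAdj] at h1 h2 h3
    simp only [Prod.ext_iff]
    simp only [rayCrossing] at hne0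
    split_ifs at hne0 <;> omega
  have hix : ∀ i ≤ n, π (x i) = (a, b + 1) → i = m := by
    intro i hi h
    by_contra him
    rcases lt_or_gt_of_ne him with h' | h'
    · exact hsimple i m h' hmn.le (Or.inr hmn) (h.trans hv.symm)
    · exact hsimple m i h' hi (Or.inl hm0) (hv.trans h.symm)
  have hmem : ∀ k < n, rayCrossing (a, b) (π (x k)) (π (x (k + 1))) ≠ 0 →
      (∀ i < n, i ≠ k → rayCrossing (a, b) (π (x i)) (π (x (i + 1))) = 0) →
      (a, b) ∈ {c | ¬ IsOuterCell M R c} := by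
    intro k hk hk0 hik hout
    have h0 := hout.crossingNumber_eq_zero (v := fun i => π (x i)) (n := n)
      (fun i hi => hT.edge (hx i hi)) hcl
    rw [crossingNumber, Finset.sum_eq_single_of_mem k (Finset.mem_range.2 hk)
      fun i hi hne => hik i (Finset.mem_range.1 hi) hne] at h0
    exact hk0 h0
  rcases hu' with hu' | hu' <;> rcases hw' with hw' | hw'
  · exact absurd (hu'.trans hw'.symm) huw
  · have hP : (a, b) ∈ {c | ¬ IsOuterCell M R c} := by
      refine hmem m hmn (by simp [rayCrossing, hv, hw']) fun i hi him => ?_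
      by_contra h0
      rcases hcross i hi h0 with h | h
      · exact him (hix i hi.le h.1)
      · have := hix (i + 1) hi h.2
        have hi' : i = m - 1 := by omega
        rw [hi', hu'] at h
        simp at h
    obtain ⟨y, hy, hy1, hy2⟩ := hT.flat hP hu' hv hw' hxm hxm'
    exact ⟨y, by simp [hy, hv], hy1, hy2, Or.inl (by simp [hy, hu'])⟩
  · have hP : (a, b) ∈ {c | ¬ IsOuterCell M R c} := by
      refine hmem (m - 1) (by omega) ?_ fun i hi him => ?_
      · rw [Nat.sub_add_cancel hm0]
        simp [rayCrossing, hv, hu']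
      by_contra h0
      rcases hcross i hi h0 with h | h
      · rw [hix i hi.le h.1, hw'] at h
        simp at h
      · have := hix (i + 1) hi h.2
        omega
    obtain ⟨y, hy, hy1, hy2⟩ := hT.flat hP hw' hv hu' (hT.symm hxm') (hT.symm hxm)
    exact ⟨y, by simp [hy, hv], hT.symm hy2, hT.symm hy1, Or.inr (by simp [hy, hw'])⟩
  · exact absurd (hu'.trans hw'.symm) huw

/-- A flat transport over cells without holes has trivial holonomy. -/
theorem eq_of_closed_walk {M : Set (ℤ × ℤ)} {R : ℤ}
    (hT : IsFlatTransport π {c | ¬ IsOuterCell M R c} T) (L : ℤ) (n : ℕ) :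
    ∀ x : ℕ → X, (∀ i < n, T (x i) (x (i + 1))) → (∀ i ≤ n, L ≤ (π (x i)).2) →
      π (x n) = π (x 0) → x n = x 0 := by
  induction n using Nat.strong_induction_on with
  | _ n ih =>
  -- Second induction, on the excess `s` of the sum of the heights over its least possible value `n
  -- * L`. Lowering a vertex keeps the length and the bound `L`, and decreases `s` by one.
  suffices H : ∀ s : ℕ, ∀ x : ℕ → X, (∀ i < n, T (x i) (x (i + 1))) →
      (∀ i ≤ n, L ≤ (π (x i)).2) → π (x n) = π (x 0) →
      ∑ i ∈ Finset.range n, (π (x i)).2 = n * L + s → x n = x 0 by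
    intro x hx hL hcl
    have hsum : n * L ≤ ∑ i ∈ Finset.range n, (π (x i)).2 := by
      have := Finset.card_nsmul_le_sum (Finset.range n) (fun i => (π (x i)).2) L
        fun i hi => hL i (Finset.mem_range.1 hi).le
      simpa using this
    refine H (∑ i ∈ Finset.range n, (π (x i)).2 - n * L).toNat x hx hL hcl ?_
    rw [Int.toNat_of_nonneg (by omega)]
    ring
  intro s
  induction s using Nat.strong_induction_on with
  | _ s ihs =>
  have core : ∀ x : ℕ → X, (∀ i < n, T (x i) (x (i + 1))) → (∀ i ≤ n, L ≤ (π (x i)).2) →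
      π (x n) = π (x 0) → ∑ i ∈ Finset.range n, (π (x i)).2 = n * L + s → ∀ m, 0 < m → m < n →
      (∀ i ≤ n, (π (x i)).2 < (π (x m)).2 ∨
        ((π (x i)).2 = (π (x m)).2 ∧ (π (x m)).1 ≤ (π (x i)).1)) → x n = x 0 := by
    intro x hx hL hcl hsum m hm0 hmn hmax
    by_contra hne
    obtain ⟨y, hy, hy1, hy2, hyL⟩ := hT.exists_lower hx hcl
      (fun i j hij hj h0 => ne_of_minimal ih hx hL hcl hne hij hj h0) hne hm0 hmn hmax
    have hLy : L ≤ (π y).2 := by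
      rcases hyL with h | h <;> rw [h] <;> exact hL _ (by omega)
    have hL' : ∀ i ≤ n, L ≤ (π (Function.update x m y i)).2 := by
      intro i hi
      rcases eq_or_ne i m with him | him
      · subst him; simpa using hLy
      · rw [Function.update_of_ne him]
        exact hL i hi
    have hsum' : ∑ i ∈ Finset.range n, (π (Function.update x m y i)).2 + 1 = n * L + s := by
      rw [← hsum, Finset.sum_eq_sum_sdiff_singleton_add (Finset.mem_range.2 hmn),
        Finset.sum_eq_sum_sdiff_singleton_add (s := Finset.range n) (Finset.mem_range.2 hmn)
        (fun i => (π (x i)).2), Function.update_self, add_assoc, hy]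
      congr 1
      refine Finset.sum_congr rfl fun i hi => ?_
      rw [Function.update_of_ne]
      simpa using (Finset.mem_sdiff.1 hi).2
    have hsum0 : n * L ≤ ∑ i ∈ Finset.range n, (π (Function.update x m y i)).2 := by
      have := Finset.card_nsmul_le_sum (Finset.range n)
        (fun i => (π (Function.update x m y i)).2) L
        fun i hi => hL' i (Finset.mem_range.1 hi).le
      simpa using this
    have := ihs (s - 1) (by omega) (Function.update x m y) ?_ hL' ?_ (by omega)
    · rw [Function.update_of_ne (by omega), Function.update_of_ne (by omega)] at this
      exact hne this
    · intro i hi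
      rcases eq_or_ne i m with him | him
      · subst him
        rw [Function.update_self, Function.update_of_ne (by omega)]
        exact hy2
      · rcases eq_or_ne (i + 1) m with him' | him'
        · subst him'
          rw [Function.update_self, Function.update_of_ne (by omega)]
          exact hy1
        · rw [Function.update_of_ne him, Function.update_of_ne him']
          exact hx i hi
    · rw [Function.update_of_ne (by omega), Function.update_of_ne (by omega)]
      exact hcl
  intro x hx hL hcl hsum
  rcases Nat.eq_zero_or_pos n with hn0 | hn0
  · rw [hn0]
  have hn1 : n ≠ 1 := by
    intro h
    have h1 := (hT.edge (hx 0 hn0)).1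
    rw [h] at hcl
    rw [hcl, LatticeAdj] at h1
    omega
  obtain ⟨m, hm, hmax⟩ := Finset.exists_max_image (Finset.range n)
    (fun i => toLex ((π (x i)).2, -(π (x i)).1)) ⟨0, Finset.mem_range.2 hn0⟩
  have hmn := Finset.mem_range.1 hm
  have hmax' : ∀ i ≤ n, (π (x i)).2 < (π (x m)).2 ∨
      ((π (x i)).2 = (π (x m)).2 ∧ (π (x m)).1 ≤ (π (x i)).1) := by
    have h1 : ∀ i < n, (π (x i)).2 < (π (x m)).2 ∨
        ((π (x i)).2 = (π (x m)).2 ∧ (π (x m)).1 ≤ (π (x i)).1) := by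
      intro i hi
      have := hmax i (Finset.mem_range.2 hi)
      rw [Prod.Lex.le_iff] at this
      simpa using this
    intro i hi
    rcases hi.lt_or_eq with hi | hi
    · exact h1 i hi
    · rw [hi, hcl]
      exact h1 0 hn0
  -- A top vertex at the base point cannot be lowered directly. The walk is rotated by one step,
  -- with the lift `y` of its first edge from `x n` appended; the top vertex then has index `n - 1`.
  -- Once `y = x 1`, uniqueness of transport gives `x n = x 0`.
  rcases Nat.eq_zero_or_pos m with hm0 | hm0
  · subst hm0
    obtain ⟨y, hy, hyT⟩ := hT.lift (hx 0 hn0) hcl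
    set x' : ℕ → X := fun i => if i < n then x (i + 1) else y with hx'
    have hlt : ∀ i < n, x' i = x (i + 1) := fun i hi => by simp [hx', hi]
    have hn : x' n = y := by simp [hx']
    have h1 := core x' ?_ ?_ ?_ ?_ (n - 1) (by omega) (by omega) ?_
    · rw [hn, hlt 0 hn0] at h1
      rw [h1] at hyT
      exact hT.unique (hT.symm hyT) (hT.symm (hx 0 hn0)) hcl
    · intro i hi
      rw [hlt i hi]
      rcases (Nat.succ_le_of_lt hi).lt_or_eq with h | h
      · rw [hlt _ h]
        exact hx _ h
      · have h' : i + 1 = n := h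
        rw [h', hn]
        exact hyT
    · intro i hi
      rcases hi.lt_or_eq with h | h
      · rw [hlt i h]
        exact hL _ h
      · rw [h, hn, hy]
        exact hL _ hn0
    · rw [hn, hlt 0 hn0, hy]
    · rw [← hsum, Finset.sum_congr rfl fun i hi => by rw [hlt i (Finset.mem_range.1 hi)]]
      have h2 := Finset.sum_range_succ (fun i => (π (x i)).2) n
      rw [Finset.sum_range_succ', hcl] at h2
      linarith
    · have h3 : x' (n - 1) = x n := by
        rw [hlt _ (by omega), Nat.sub_add_cancel hn0]
      intro i hi
      rw [h3, hcl]
      rcases hi.lt_or_eq with h | h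
      · rw [hlt i h]
        exact hmax' _ h
      · rw [h, hn, hy]
        exact hmax' _ hn0
  · exact core x hx hL hcl hsum m hm0 hmn hmax'

end IsFlatTransport

/-! ### Lattice cells in the plane -/

/-- The lattice point `v` at mesh size `ε`. -/
def latticePoint (ε : ℝ) (v : ℤ × ℤ) : ℂ := ⟨ε * v.1, ε * v.2⟩

/-- The closed lattice cell `c` at mesh size `ε`. -/
def latticeCell (ε : ℝ) (c : ℤ × ℤ) : Set ℂ :=
  {z | (ε * c.1 ≤ z.re ∧ z.re ≤ ε * (c.1 + 1)) ∧ (ε * c.2 ≤ z.im ∧ z.im ≤ ε * (c.2 + 1))}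

theorem isClosed_latticeCell (ε : ℝ) (c : ℤ × ℤ) : IsClosed (latticeCell ε c) :=
  ((isClosed_le continuous_const Complex.continuous_re).inter
    (isClosed_le Complex.continuous_re continuous_const)).inter
  ((isClosed_le continuous_const Complex.continuous_im).inter
    (isClosed_le Complex.continuous_im continuous_const))

theorem convex_latticeCell (ε : ℝ) (c : ℤ × ℤ) : Convex ℝ (latticeCell ε c) :=
  ((convex_halfSpace_re_ge _).inter (convex_halfSpace_re_le _)).inter
    ((convex_halfSpace_im_ge _).inter (convex_halfSpace_im_le _))

theorem latticePoint_mem_latticeCell {ε : ℝ} (hε : 0 < ε) {c u : ℤ × ℤ} (h : IsCellCorner c u) :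
    latticePoint ε u ∈ latticeCell ε c := by
  obtain ⟨h1, h2, h3, h4⟩ := h
  have h1' : (c.1 : ℝ) ≤ u.1 := by exact_mod_cast h1
  have h2' : (u.1 : ℝ) ≤ c.1 + 1 := by exact_mod_cast h2
  have h3' : (c.2 : ℝ) ≤ u.2 := by exact_mod_cast h3
  have h4' : (u.2 : ℝ) ≤ c.2 + 1 := by exact_mod_cast h4
  exact ⟨⟨mul_le_mul_of_nonneg_left h1' hε.le, mul_le_mul_of_nonneg_left h2' hε.le⟩,
    mul_le_mul_of_nonneg_left h3' hε.le, mul_le_mul_of_nonneg_left h4' hε.le⟩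

theorem exists_mem_latticeCell {ε : ℝ} (hε : 0 < ε) (z : ℂ) : ∃ c, z ∈ latticeCell ε c := by
  refine ⟨(⌊z.re / ε⌋, ⌊z.im / ε⌋), ?_, ?_⟩
  · have h1 := Int.floor_le (z.re / ε)
    have h2 := (Int.lt_floor_add_one (z.re / ε)).le
    rw [le_div_iff₀' hε] at h1
    rw [div_le_iff₀' hε] at h2
    exact ⟨h1, h2⟩
  · have h1 := Int.floor_le (z.im / ε)
    have h2 := (Int.lt_floor_add_one (z.im / ε)).le
    rw [le_div_iff₀' hε] at h1
    rw [div_le_iff₀' hε] at h2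
    exact ⟨h1, h2⟩

theorem exists_common_corner {ε : ℝ} (hε : 0 < ε) {c d : ℤ × ℤ} {z : ℂ}
    (hc : z ∈ latticeCell ε c) (hd : z ∈ latticeCell ε d) :
    ∃ u, IsCellCorner c u ∧ IsCellCorner d u := by
  obtain ⟨⟨a1, a2⟩, a3, a4⟩ := hc
  obtain ⟨⟨b1, b2⟩, b3, b4⟩ := hd
  have key : ∀ i j : ℤ, ∀ t : ℝ, ε * i ≤ t → t ≤ ε * (j + 1) → i ≤ j + 1 := by
    intro i j t h1 h2
    have := le_of_mul_le_mul_left (h1.trans h2) hε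
    exact_mod_cast this
  have h1 := key _ _ _ a1 b2
  have h2 := key _ _ _ b1 a2
  have h3 := key _ _ _ a3 b4
  have h4 := key _ _ _ b3 a4
  refine ⟨(max c.1 d.1, max c.2 d.2), ?_, ?_⟩ <;> simp only [IsCellCorner] <;> omega

/-! ### Filling of lattice neighbourhoods -/

section Outer

variable {M : Set (ℤ × ℤ)} {R : ℤ}

theorem IsOuterCell.horizontal {a b a' : ℤ} (h : IsOuterCell M R (a, b))
    (hM : ∀ i, min a a' ≤ i → i ≤ max a a' → (i, b) ∉ M) : IsOuterCell M R (a', b) := by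
  rcases le_total a a' with haa | haa
  · refine Int.leInduction (motive := fun i _ => i ≤ a' → IsOuterCell M R (i, b)) (fun _ => h)
      (fun i hi ih hi' => ?_) a' haa le_rfl
    exact .step (i, b) _ (ih (by omega)) (Or.inr ⟨rfl, Or.inl rfl⟩) (hM _ (by omega) (by omega))
  · refine Int.leInductionDown (motive := fun i _ => a' ≤ i → IsOuterCell M R (i, b)) (fun _ => h)
      (fun i hi ih hi' => ?_) a' haa le_rfl
    exact .step (i, b) _ (ih (by omega)) (Or.inr ⟨rfl, Or.inr (by simp)⟩)
      (hM _ (by omega) (by omega))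

theorem IsOuterCell.vertical {a b b' : ℤ} (h : IsOuterCell M R (a, b))
    (hM : ∀ j, min b b' ≤ j → j ≤ max b b' → (a, j) ∉ M) : IsOuterCell M R (a, b') := by
  rcases le_total b b' with hbb | hbb
  · refine Int.leInduction (motive := fun i _ => i ≤ b' → IsOuterCell M R (a, i)) (fun _ => h)
      (fun i hi ih hi' => ?_) b' hbb le_rfl
    exact .step (a, i) _ (ih (by omega)) (Or.inl ⟨rfl, Or.inl rfl⟩) (hM _ (by omega) (by omega))
  · refine Int.leInductionDown (motive := fun i _ => b' ≤ i → IsOuterCell M R (a, i)) (fun _ => h)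
      (fun i hi ih hi' => ?_) b' hbb le_rfl
    exact .step (a, i) _ (ih (by omega)) (Or.inl ⟨rfl, Or.inr (by simp)⟩)
      (hM _ (by omega) (by omega))

/-- Columns beside the square come down from the half-plane at height `R`; rows below it are then
reached sideways from such a column. -/
theorem isOuterCell_of_far (hM : ∀ c ∈ M, -R ≤ c.1 ∧ c.1 < R ∧ -R ≤ c.2 ∧ c.2 < R) {c : ℤ × ℤ}
    (hc : c.1 < -R ∨ R ≤ c.1 ∨ c.2 < -R ∨ R ≤ c.2) : IsOuterCell M R c := by
  have hcol : ∀ a b : ℤ, (a < -R ∨ R ≤ a) → IsOuterCell M R (a, b) := by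
    intro a b ha
    refine IsOuterCell.vertical (b := R) (.top (a, R) le_rfl) fun j _ _ hj => ?_
    have := hM _ hj
    simp only at this
    omega
  obtain ⟨a, b⟩ := c
  rcases hc with h | h | h | h
  · exact hcol _ _ (Or.inl h)
  · exact hcol _ _ (Or.inr h)
  · refine IsOuterCell.horizontal (hcol R b (Or.inr le_rfl)) fun j _ _ hj => ?_
    have := hM _ hj
    simp only at this h
    omega
  · exact .top _ h

end Outer

/-- The lattice cells of mesh size `ε` that meet `K`. -/
def cellsMeeting (K : Set ℂ) (ε : ℝ) : Set (ℤ × ℤ) := {c | (latticeCell ε c ∩ K).Nonempty}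

theorem cellsMeeting_bounded {K : Set ℂ} {ε r : ℝ} (hε : 0 < ε) (hK : K ⊆ Metric.ball 0 r)
    (c : ℤ × ℤ) (hc : c ∈ cellsMeeting K ε) :
    -(⌈r / ε⌉ + 1) ≤ c.1 ∧ c.1 < ⌈r / ε⌉ + 1 ∧ -(⌈r / ε⌉ + 1) ≤ c.2 ∧ c.2 < ⌈r / ε⌉ + 1 := by
  obtain ⟨z, ⟨⟨h1, h2⟩, h3, h4⟩, hz⟩ := hc
  have hzr : ‖z‖ < r := by simpa using hK hz
  have hre := abs_le.1 ((Complex.abs_re_le_norm z).trans hzr.le)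
  have him := abs_le.1 ((Complex.abs_im_le_norm z).trans hzr.le)
  have hR : r ≤ ε * ⌈r / ε⌉ := by
    rw [← div_le_iff₀' hε]
    exact Int.le_ceil _
  have key1 : ∀ i : ℤ, ε * i ≤ r → i < ⌈r / ε⌉ + 1 := by
    intro i hi
    have h : (i : ℝ) ≤ ⌈r / ε⌉ := le_of_mul_le_mul_left (hi.trans hR) hε
    have : i ≤ ⌈r / ε⌉ := by exact_mod_cast h
    omega
  have key2 : ∀ i : ℤ, -r ≤ ε * (i + 1) → -(⌈r / ε⌉ + 1) ≤ i := by
    intro i hi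
    have h : -(⌈r / ε⌉ : ℝ) ≤ i + 1 := le_of_mul_le_mul_left (a := ε) (by linarith) hε
    have : -⌈r / ε⌉ ≤ i + 1 := by exact_mod_cast h
    omega
  exact ⟨key2 _ (hre.1.trans h2), key1 _ (h1.trans hre.2), key2 _ (him.1.trans h4),
    key1 _ (h3.trans him.2)⟩

/-- `c` is reachable from far away outside the cells of mesh size `ε` that meet `K`. -/
def IsOuterCellOf (K : Set ℂ) (r ε : ℝ) (c : ℤ × ℤ) : Prop :=
  IsOuterCell (cellsMeeting K ε) (⌈r / ε⌉ + 1) c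

/-- All cells of small mesh size that meet `S` are outer cells. -/
def EventuallyOuter (K : Set ℂ) (r : ℝ) (S : Set ℂ) : Prop :=
  ∃ ε₀ > 0, ∀ ε, 0 < ε → ε < ε₀ → ∀ c, (latticeCell ε c ∩ S).Nonempty → IsOuterCellOf K r ε c

theorem EventuallyOuter.mono {K : Set ℂ} {r : ℝ} {S S' : Set ℂ} (h : EventuallyOuter K r S)
    (hS : S' ⊆ S) : EventuallyOuter K r S' := by
  obtain ⟨ε₀, h0, h⟩ := h
  exact ⟨ε₀, h0, fun ε hε hε' c hc => h ε hε hε' c (hc.mono (inter_subset_inter_right _ hS))⟩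

theorem EventuallyOuter.union {K : Set ℂ} {r : ℝ} {S S' : Set ℂ} (h : EventuallyOuter K r S)
    (h' : EventuallyOuter K r S') : EventuallyOuter K r (S ∪ S') := by
  obtain ⟨ε₁, h1, h⟩ := h
  obtain ⟨ε₂, h2, h'⟩ := h'
  refine ⟨min ε₁ ε₂, lt_min h1 h2, fun ε hε hε' c hc => ?_⟩
  rw [inter_union_distrib_left, union_nonempty] at hc
  rcases hc with hc | hc
  · exact h ε hε (hε'.trans_le (min_le_left _ _)) c hc
  · exact h' ε hε (hε'.trans_le (min_le_right _ _)) c hc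

/-- An L-shaped chain of cells joins `c` to `d`. Its points are within `2 * ρ` of `q` in each
coordinate because `ε < ρ`, hence within `4 * ρ` in norm, so the chain avoids `K`. -/
theorem IsOuterCellOf.of_ball {K : Set ℂ} {r ε ρ : ℝ} {q : ℂ} (hε : 0 < ε) (hερ : ε < ρ)
    (hK : Disjoint (Metric.ball q (4 * ρ)) K) {c d : ℤ × ℤ}
    (hc : (latticeCell ε c ∩ Metric.ball q ρ).Nonempty)
    (hd : (latticeCell ε d ∩ Metric.ball q ρ).Nonempty) (h : IsOuterCellOf K r ε c) :
    IsOuterCellOf K r ε d := by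
  obtain ⟨z, ⟨⟨a1, a2⟩, a3, a4⟩, hz⟩ := hc
  obtain ⟨w, ⟨⟨b1, b2⟩, b3, b4⟩, hw⟩ := hd
  rw [Metric.mem_ball, dist_eq_norm] at hz hw
  have hz1 := abs_lt.1 ((Complex.abs_re_le_norm _).trans_lt hz)
  have hz2 := abs_lt.1 ((Complex.abs_im_le_norm _).trans_lt hz)
  have hw1 := abs_lt.1 ((Complex.abs_re_le_norm _).trans_lt hw)
  have hw2 := abs_lt.1 ((Complex.abs_im_le_norm _).trans_lt hw)
  simp only [Complex.sub_re, Complex.sub_im] at hz1 hz2 hw1 hw2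
  have key : ∀ k l i : ℤ, ∀ t s y x : ℝ, ε * k ≤ t → t ≤ ε * (k + 1) → ε * l ≤ s →
      s ≤ ε * (l + 1) → -ρ < t - y → t - y < ρ → -ρ < s - y → s - y < ρ → min k l ≤ i →
      i ≤ max k l → ε * i ≤ x → x ≤ ε * (i + 1) → |x - y| < 2 * ρ := by
    intro k l i t s y x h1 h2 h3 h4 h5 h6 h7 h8 h9 h10 h11 h12
    rw [abs_lt]
    constructor
    · rcases min_le_iff.1 h9 with h | h
      · have : ε * k ≤ ε * i := mul_le_mul_of_nonneg_left (by exact_mod_cast h) hε.le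
        nlinarith
      · have : ε * l ≤ ε * i := mul_le_mul_of_nonneg_left (by exact_mod_cast h) hε.le
        nlinarith
    · rcases le_max_iff.1 h10 with h | h
      · have : ε * i ≤ ε * k := mul_le_mul_of_nonneg_left (by exact_mod_cast h) hε.le
        nlinarith
      · have : ε * i ≤ ε * l := mul_le_mul_of_nonneg_left (by exact_mod_cast h) hε.le
        nlinarith
  have hM : ∀ i j : ℤ, min c.1 d.1 ≤ i → i ≤ max c.1 d.1 → min c.2 d.2 ≤ j → j ≤ max c.2 d.2 →
      (i, j) ∉ cellsMeeting K ε := by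
    rintro i j hi hi' hj hj' ⟨x, ⟨⟨x1, x2⟩, x3, x4⟩, hxK⟩
    refine disjoint_left.1 hK ?_ hxK
    have h1 := key _ _ _ _ _ _ _ a1 a2 b1 b2 hz1.1 hz1.2 hw1.1 hw1.2 hi hi' x1 x2
    have h2 := key _ _ _ _ _ _ _ a3 a4 b3 b4 hz2.1 hz2.2 hw2.1 hw2.2 hj hj' x3 x4
    rw [Metric.mem_ball, dist_eq_norm]
    have h3 := Complex.norm_le_abs_re_add_abs_im (x - q)
    simp only [Complex.sub_re, Complex.sub_im] at h3
    linarith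
  have h1 : IsOuterCellOf K r ε (d.1, c.2) :=
    IsOuterCell.horizontal (a := c.1) h fun i hi hi' =>
      hM i c.2 hi hi' (min_le_left _ _) (le_max_left _ _)
  exact IsOuterCell.vertical (b := c.2) (b' := d.2) h1 fun j hj hj' =>
    hM d.1 j (min_le_right _ _) (le_max_right _ _) hj hj'

/-- If the complement of the compact set `K` is connected, then every point outside `K` has a
neighbourhood that meets only outer cells of small mesh size. -/
theorem exists_eventuallyOuter_ball {K : Set ℂ} {r : ℝ} (hK : IsClosed K) (hKc : IsPreconnected Kᶜ)
    (hKr : K ⊆ Metric.ball 0 r) (hr : 0 < r) {q : ℂ} (hq : q ∉ K) :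
    ∃ ρ > 0, EventuallyOuter K r (Metric.ball q ρ) := by
  set G : Set ℂ := {q | ∃ ρ > 0, EventuallyOuter K r (Metric.ball q ρ)} with hG
  have hGo : IsOpen G := by
    rw [Metric.isOpen_iff]
    rintro q ⟨ρ, hρ, h⟩
    refine ⟨ρ / 2, by linarith, fun q' hq' => ⟨ρ / 2, by linarith, h.mono ?_⟩⟩
    refine Metric.ball_subset_ball' ?_
    have := (Metric.mem_ball.1 hq').le
    linarith
  suffices h : Kᶜ ⊆ G from h hq
  refine hKc.subset_of_closure_inter_subset hGo ?_ ?_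
  -- A base point high enough that, for `ε < 1`, all cells meeting its unit ball lie above the
  -- starting height `⌈r / ε⌉ + 1`.
  · refine ⟨⟨0, r + 6⟩, ?_, 1, one_pos, 1, one_pos, fun ε hε hε1 c hc => ?_⟩
    · intro h
      have h1 := hKr h
      rw [mem_ball_zero_iff] at h1
      have h2 := (le_abs_self _).trans (Complex.abs_im_le_norm (⟨0, r + 6⟩ : ℂ))
      simp only at h2
      linarith
    · obtain ⟨z, ⟨-, -, h4⟩, hz⟩ := hc
      rw [Metric.mem_ball, dist_eq_norm] at hz
      have hz2 := (abs_lt.1 ((Complex.abs_im_le_norm _).trans_lt hz)).1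
      simp only [Complex.sub_im] at hz2
      refine .top _ ?_
      have h5 : (⌈r / ε⌉ : ℝ) < r / ε + 1 := Int.ceil_lt_add_one _
      have h6 : ε * (r / ε + 3) < ε * (c.2 + 1) := by
        have : ε * (r / ε + 3) = r + 3 * ε := by field_simp
        nlinarith
      have h7 : r / ε + 3 < c.2 + 1 := lt_of_mul_lt_mul_left h6 hε.le
      have h8 : ((⌈r / ε⌉ + 1 : ℤ) : ℝ) ≤ c.2 := by push_cast; linarith
      exact_mod_cast h8
  · rintro q ⟨hq, hqK⟩
    obtain ⟨δ, hδ, hball⟩ := Metric.isOpen_iff.1 hK.isOpen_compl q hqK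
    have hdisj : Disjoint (Metric.ball q (4 * (δ / 4))) K := by
      rw [show 4 * (δ / 4) = δ by ring]
      exact disjoint_left.2 fun x hx => hball hx
    obtain ⟨q', hq', ⟨ρ, hρ, ε₀, hε₀, h⟩⟩ := mem_closure_iff_nhds.1 hq _
      (Metric.ball_mem_nhds q (show 0 < δ / 4 by linarith))
    refine ⟨δ / 4, by linarith, min ε₀ (δ / 4), lt_min hε₀ (by linarith), fun ε hε hε' d hd => ?_⟩
    obtain ⟨c, hc⟩ := exists_mem_latticeCell hε q'
    exact IsOuterCellOf.of_ball hε (hε'.trans_le (min_le_right _ _)) hdisj ⟨q', hc, hq'⟩ hd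
      (h ε hε (hε'.trans_le (min_le_left _ _)) c ⟨q', hc, Metric.mem_ball_self hρ⟩)

/-- A compact set with connected complement has, in each of its neighbourhoods, a lattice
neighbourhood without holes. -/
theorem exists_lattice_neighbourhood {K N : Set ℂ} (hK : IsCompact K) (hKc : IsPreconnected Kᶜ)
    (hN : IsOpen N) (hKN : K ⊆ N) :
    ∃ ε > 0, ∃ R : ℤ, (∀ c ∈ cellsMeeting K ε, -R ≤ c.1 ∧ c.1 < R ∧ -R ≤ c.2 ∧ c.2 < R) ∧
      ∀ c, ¬ IsOuterCell (cellsMeeting K ε) R c → latticeCell ε c ⊆ N := by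
  obtain ⟨r, hr, hKr⟩ := hK.isBounded.subset_ball_lt 0 0
  -- Since `ε ≤ 1`, every cell that is not outer lies in the square of half-side `r + 3`, hence in
  -- this ball. So only points of the ball outside `N` need to be covered by outer cells.
  have hQ : IsCompact (Metric.closedBall (0 : ℂ) (2 * (r + 3)) \ N) :=
    (isCompact_closedBall _ _).diff hN
  have hout : EventuallyOuter K r (Metric.closedBall (0 : ℂ) (2 * (r + 3)) \ N) := by
    refine hQ.induction_on (p := EventuallyOuter K r) ?_ (fun s t hst ht => ht.mono hst)
      (fun s t hs ht => hs.union ht) fun q hq => ?_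
    · exact ⟨1, one_pos, fun ε _ _ c hc => by simp at hc⟩
    · obtain ⟨ρ, hρ, h⟩ := exists_eventuallyOuter_ball hK.isClosed hKc hKr hr
        (fun h => hq.2 (hKN h))
      exact ⟨_, mem_nhdsWithin_of_mem_nhds (Metric.ball_mem_nhds q hρ), h⟩
  obtain ⟨ε₀, hε₀, h⟩ := hout
  have hε : 0 < min (ε₀ / 2) 1 := lt_min (by linarith) one_pos
  have hε₁ : min (ε₀ / 2) 1 < ε₀ := (min_le_left _ _).trans_lt (by linarith)
  have hε2 : min (ε₀ / 2) 1 ≤ 1 := min_le_right _ _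
  generalize min (ε₀ / 2) 1 = ε at hε hε₁ hε2
  have hbd := cellsMeeting_bounded hε hKr
  refine ⟨ε, hε, ⌈r / ε⌉ + 1, hbd, fun c hc z hz => ?_⟩
  by_contra hzN
  have hfar : ¬ (c.1 < -(⌈r / ε⌉ + 1) ∨ ⌈r / ε⌉ + 1 ≤ c.1 ∨ c.2 < -(⌈r / ε⌉ + 1) ∨
      ⌈r / ε⌉ + 1 ≤ c.2) := fun hf => hc (isOuterCell_of_far hbd hf)
  refine hc (h ε hε hε₁ c ⟨z, hz, ?_, hzN⟩)
  have hceil : ε * ⌈r / ε⌉ ≤ r + ε := by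
    have := (Int.ceil_lt_add_one (r / ε)).le
    calc ε * ⌈r / ε⌉ ≤ ε * (r / ε + 1) := mul_le_mul_of_nonneg_left this hε.le
      _ = r + ε := by field_simp
  have key : ∀ i : ℤ, ∀ t : ℝ, ¬ i < -(⌈r / ε⌉ + 1) → ¬ ⌈r / ε⌉ + 1 ≤ i → ε * i ≤ t →
      t ≤ ε * (i + 1) → |t| ≤ r + 3 := by
    intro i t h1 h2 h3 h4
    have h1' : (-(⌈r / ε⌉ + 1) : ℝ) ≤ i := by exact_mod_cast not_lt.1 h1
    have h2' : (i : ℝ) ≤ ⌈r / ε⌉ := by exact_mod_cast (by omega : i ≤ ⌈r / ε⌉)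
    have h5 := mul_le_mul_of_nonneg_left h1' hε.le
    have h6 := mul_le_mul_of_nonneg_left h2' hε.le
    rw [abs_le]
    constructor <;> nlinarith
  have h1 := key _ _ (fun h => hfar (Or.inl h)) (fun h => hfar (Or.inr (Or.inl h))) hz.1.1 hz.1.2
  have h2 := key _ _ (fun h => hfar (Or.inr (Or.inr (Or.inl h))))
    (fun h => hfar (Or.inr (Or.inr (Or.inr h)))) hz.2.1 hz.2.2
  rw [mem_closedBall_zero_iff]
  linarith [Complex.norm_le_abs_re_add_abs_im z]

/-! ### Gluing sections over a continuum with connected complement -/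

/-- `s` is a continuous section of `p` over `ψ` on the set `D`. -/
def IsSectionOn {Y X : Type*} [TopologicalSpace Y] (p : Y → X) (ψ : ℂ → X) (D : Set ℂ)
    (s : ℂ → Y) : Prop :=
  ContinuousOn s D ∧ ∀ w ∈ D, p (s w) = ψ w

section Section

variable {Y X : Type*} [TopologicalSpace Y] {p : Y → X} {ψ : ℂ → X} {ε : ℝ}

theorem IsSectionOn.mono {D D' : Set ℂ} {s : ℂ → Y} (h : IsSectionOn p ψ D s) (hD : D' ⊆ D) :
    IsSectionOn p ψ D' s :=
  ⟨h.1.mono hD, fun w hw => h.2 w (hD hw)⟩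

theorem IsSectionOn.eqOn [T2Space Y] (hp : IsLocallyInjective p) {D : Set ℂ} {s s' : ℂ → Y}
    (hD : IsPreconnected D) (h : IsSectionOn p ψ D s) (h' : IsSectionOn p ψ D s') {w : ℂ}
    (hw : w ∈ D) (hs : s w = s' w) : EqOn s s' D :=
  (T2Space.isSeparatedMap p).eqOn_of_comp_eqOn hp hD h.1 h'.1
    (fun z hz => (h.2 z hz).trans (h'.2 z hz).symm) hw hs

theorem IsSectionOn.eqOn_segment [T2Space Y] (hp : IsLocallyInjective p) {u w : ℂ} {s s' : ℂ → Y}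
    (h : IsSectionOn p ψ (segment ℝ u w) s) (h' : IsSectionOn p ψ (segment ℝ u w) s')
    (hs : s u = s' u) : s w = s' w :=
  h.eqOn hp (convex_segment u w).isPreconnected h' (left_mem_segment ℝ u w) hs
    (right_mem_segment ℝ u w)

variable (p ψ ε) in
/-- Lattice points together with a point above them. -/
def LiftedPoint : Type _ := {x : (ℤ × ℤ) × Y // p x.2 = ψ (latticePoint ε x.1)}

variable (p ψ ε) in
/-- Two lifted lattice points are joined by a section over an edge of a cell in `P`. -/
def EdgeTransport (P : Set (ℤ × ℤ)) (x y : LiftedPoint p ψ ε) : Prop :=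
  IsCellEdge P x.1.1 y.1.1 ∧
    ∃ s, IsSectionOn p ψ (segment ℝ (latticePoint ε x.1.1) (latticePoint ε y.1.1)) s ∧
      s (latticePoint ε x.1.1) = x.1.2 ∧ s (latticePoint ε y.1.1) = y.1.2

theorem LatticeAdj.symm {u w : ℤ × ℤ} (h : LatticeAdj u w) : LatticeAdj w u := by
  simp only [LatticeAdj] at *
  omega

theorem segment_subset_latticeCell (hε : 0 < ε) {c u w : ℤ × ℤ} (hu : IsCellCorner c u)
    (hw : IsCellCorner c w) :
    segment ℝ (latticePoint ε u) (latticePoint ε w) ⊆ latticeCell ε c :=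
  (convex_latticeCell ε c).segment_subset (latticePoint_mem_latticeCell hε hu)
    (latticePoint_mem_latticeCell hε hw)

/-- The value of a section over a cell, as a lifted lattice point. -/
def IsSectionOn.lifted (hε : 0 < ε) {c u : ℤ × ℤ} {s : ℂ → Y}
    (h : IsSectionOn p ψ (latticeCell ε c) s) (hu : IsCellCorner c u) : LiftedPoint p ψ ε :=
  ⟨(u, s (latticePoint ε u)), h.2 _ (latticePoint_mem_latticeCell hε hu)⟩

theorem IsSectionOn.edgeTransport (hε : 0 < ε) {P : Set (ℤ × ℤ)} {c u w : ℤ × ℤ} (hc : c ∈ P)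
    {s : ℂ → Y} (h : IsSectionOn p ψ (latticeCell ε c) s) (hu : IsCellCorner c u)
    (hw : IsCellCorner c w) (huw : LatticeAdj u w) :
    EdgeTransport p ψ ε P (h.lifted hε hu) (h.lifted hε hw) :=
  ⟨⟨huw, c, hc, hu, hw⟩, s, h.mono (segment_subset_latticeCell hε hu hw), rfl, rfl⟩

theorem EdgeTransport.eq_lifted [T2Space Y] (hp : IsLocallyInjective p) (hε : 0 < ε)
    {P : Set (ℤ × ℤ)} {c : ℤ × ℤ} {s : ℂ → Y} (h : IsSectionOn p ψ (latticeCell ε c) s)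
    {x y : LiftedPoint p ψ ε} (hxy : EdgeTransport p ψ ε P x y) (hx : IsCellCorner c x.1.1)
    (hy : IsCellCorner c y.1.1) (hs : s (latticePoint ε x.1.1) = x.1.2) :
    s (latticePoint ε y.1.1) = y.1.2 := by
  obtain ⟨-, t, ht, htx, hty⟩ := hxy
  rw [← hty]
  exact (h.mono (segment_subset_latticeCell hε hx hy)).eqOn_segment hp ht (hs.trans htx.symm)

/-- A section over an edge is determined by one value, and edge sections along the boundary of a
cell are restrictions of one section over the convex cell; the latter is flatness. -/
theorem isFlatTransport_edgeTransport [T2Space Y] (hp : IsLocallyInjective p) (hε : 0 < ε)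
    {P : Set (ℤ × ℤ)}
    (hsec : ∀ c ∈ P, ∀ w ∈ latticeCell ε c, ∀ y, p y = ψ w →
      ∃ s, IsSectionOn p ψ (latticeCell ε c) s ∧ s w = y) :
    IsFlatTransport (fun x : LiftedPoint p ψ ε => x.1.1) P (EdgeTransport p ψ ε P) where
  edge h := h.1
  symm := by
    rintro x y ⟨⟨hadj, c, hc, hcx, hcy⟩, s, hs, hsx, hsy⟩
    exact ⟨⟨hadj.symm, c, hc, hcy, hcx⟩, s, by rwa [segment_symm], hsy, hsx⟩
  unique := by
    rintro ⟨⟨u, x⟩, hx⟩ ⟨⟨v, y⟩, hy⟩ ⟨⟨w, z⟩, hz⟩ ⟨-, s, hs, hsx, hsy⟩ ⟨-, t, ht, htx, htz⟩ h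
    dsimp only at *
    subst h
    have h1 := hs.eqOn_segment hp ht (hsx.trans htx.symm)
    rw [hsy, htz] at h1
    subst h1
    rfl
  lift := by
    rintro ⟨⟨u, x⟩, hx⟩ ⟨⟨v, y⟩, hy⟩ ⟨⟨w, z⟩, hz⟩ ⟨⟨hadj, c, hc, hcu, hcv⟩, -⟩ h
    dsimp only at *
    subst h
    obtain ⟨s, hs, hsz⟩ := hsec c hc _ (latticePoint_mem_latticeCell hε hcu) z hz
    subst hsz
    exact ⟨hs.lifted hε hcv, rfl, hs.edgeTransport hε hc hcu hcv hadj⟩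
  flat := by
    rintro a b ⟨⟨u, x⟩, hx⟩ ⟨⟨v, y⟩, hy⟩ ⟨⟨w, z⟩, hz⟩ hc hu hv hw hxy hyz
    dsimp only at hu hv hw
    subst hu hv hw
    have h1 : IsCellCorner (a, b) (a, b) := by simp [IsCellCorner]
    have h2 : IsCellCorner (a, b) (a, b + 1) := by simp [IsCellCorner]
    have h3 : IsCellCorner (a, b) (a + 1, b + 1) := by simp [IsCellCorner]
    have h4 : IsCellCorner (a, b) (a + 1, b) := by simp [IsCellCorner]
    obtain ⟨s, hs, hsx⟩ := hsec _ hc _ (latticePoint_mem_latticeCell hε h1) x hx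
    have hsy := hxy.eq_lifted hp hε hs h1 h2 hsx
    have hsz := hyz.eq_lifted hp hε hs h2 h3 hsy
    dsimp only at hsx hsy hsz
    subst hsx hsz
    exact ⟨hs.lifted hε h4, rfl,
      hs.edgeTransport hε hc h1 h4 (Or.inr ⟨rfl, Or.inl rfl⟩),
      hs.edgeTransport hε hc h4 h3 (Or.inl ⟨rfl, Or.inl rfl⟩)⟩

theorem exists_walk_of_reflTransGen {α : Type*} {r : α → α → Prop} {a b : α}
    (h : Relation.ReflTransGen r a b) :
    ∃ (n : ℕ) (x : ℕ → α), x 0 = a ∧ x n = b ∧ ∀ i < n, r (x i) (x (i + 1)) := by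
  induction h with
  | refl => exact ⟨0, fun _ => a, rfl, rfl, fun i hi => absurd hi (Nat.not_lt_zero i)⟩
  | @tail b c _ hbc ih =>
    obtain ⟨n, x, h0, hn, hx⟩ := ih
    refine ⟨n + 1, fun i => if i ≤ n then x i else c, by simpa using h0, by simp, fun i hi => ?_⟩
    rcases (Nat.lt_succ_iff.1 hi).lt_or_eq with h | h
    · simp only [h.le, if_true, show i + 1 ≤ n from h]
      exact hx i h
    · subst h
      simp only [le_refl, if_true, show ¬ i + 1 ≤ i by omega, if_false, hn]
      exact hbc

/-- Reversing one chain and following the other gives a closed walk, whose finitely many heights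
supply the lower bound `L`. -/
theorem IsFlatTransport.eq_of_reachable {Z : Type*} {π : Z → ℤ × ℤ} {T : Z → Z → Prop}
    {M : Set (ℤ × ℤ)} {R : ℤ} (hT : IsFlatTransport π {c | ¬ IsOuterCell M R c} T) {x₀ x y : Z}
    (hx : Relation.ReflTransGen T x₀ x) (hy : Relation.ReflTransGen T x₀ y) (h : π x = π y) :
    x = y := by
  have : Std.Symm T := ⟨fun _ _ h => hT.symm h⟩
  have hyx : Relation.ReflTransGen T y x :=
    ((Relation.ReflTransGen.stdSymm (r := T)).symm _ _ hy).trans hx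
  obtain ⟨n, z, h0, hn, hz⟩ := exists_walk_of_reflTransGen hyx
  obtain ⟨L, hL⟩ := (Set.finite_range fun i : Fin (n + 1) => (π (z i)).2).bddBelow
  have := hT.eq_of_closed_walk L n z hz (fun i hi => hL ⟨⟨i, by omega⟩, rfl⟩)
    (by rw [h0, hn, h])
  rw [← hn, this, h0]

/-- A local homeomorphism with sections over all convex subsets of an open set `N` of the plane has
sections over each continuum in `N` with connected complement. -/
theorem exists_section_of_isPreconnected_compl [TopologicalSpace X] [T2Space Y]
    (hp : IsLocalHomeomorph p) {N : Set ℂ} (hN : IsOpen N)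
    (hsec : ∀ D ⊆ N, Convex ℝ D → ∀ w ∈ D, ∀ y, p y = ψ w → ∃ s, IsSectionOn p ψ D s ∧ s w = y)
    {K : Set ℂ} (hK : IsCompact K) (hKN : K ⊆ N) (hKc : IsPreconnected K)
    (hKcc : IsPreconnected Kᶜ) {w₀ : ℂ} (hw₀ : w₀ ∈ K) {y₀ : Y} (hy₀ : p y₀ = ψ w₀) :
    ∃ s, IsSectionOn p ψ K s ∧ s w₀ = y₀ := by
  have hinj := hp.isLocallyInjective
  obtain ⟨ε, hε, R, hbd, hcell⟩ := exists_lattice_neighbourhood hK hKcc hN hKN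
  set M := cellsMeeting K ε with hM
  set P : Set (ℤ × ℤ) := {c | ¬ IsOuterCell M R c} with hP
  have hMP : M ⊆ P := by
    intro c hc hout
    cases hout with
    | top _ h => exact absurd (hbd c hc).2.2.2 (not_lt.2 h)
    | step _ _ _ _ h => exact h hc
  have hsecP : ∀ c ∈ P, ∀ w ∈ latticeCell ε c, ∀ y, p y = ψ w →
      ∃ s, IsSectionOn p ψ (latticeCell ε c) s ∧ s w = y := fun c hc =>
    hsec _ (hcell c hc) (convex_latticeCell ε c)
  have hT := isFlatTransport_edgeTransport hinj hε hsecP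
  have hMfin : M.Finite := by
    refine ((Set.finite_Ico (-R) R).prod (Set.finite_Ico (-R) R)).subset fun c hc => ?_
    have := hbd c hc
    exact ⟨⟨this.1, this.2.1⟩, this.2.2⟩
  obtain ⟨c₀, hc₀⟩ := exists_mem_latticeCell hε w₀
  have hc₀M : c₀ ∈ M := ⟨w₀, hc₀, hw₀⟩
  obtain ⟨s₀, hs₀, hs₀w⟩ := hsecP c₀ (hMP hc₀M) w₀ hc₀ y₀ hy₀
  have hself : ∀ c : ℤ × ℤ, IsCellCorner c c := fun c => by simp [IsCellCorner]
  set x₀ : LiftedPoint p ψ ε := hs₀.lifted hε (hself c₀) with hx₀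
  let reach : LiftedPoint p ψ ε → Prop := Relation.ReflTransGen (EdgeTransport p ψ ε P) x₀
  -- A cell section is good if its corner values are transported from `x₀`. Trivial holonomy leaves
  -- at most one such value over each lattice point, so good sections agree at a common corner and,
  -- along segments from it, on the whole overlap of their cells.
  let good : ℤ × ℤ → (ℂ → Y) → Prop := fun c s =>
    ∃ h : IsSectionOn p ψ (latticeCell ε c) s, ∀ u, ∀ hu : IsCellCorner c u,
      reach (h.lifted hε hu)
  have hgood_of : ∀ c ∈ P, ∀ s, ∀ h : IsSectionOn p ψ (latticeCell ε c) s, ∀ u,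
      ∀ hu : IsCellCorner c u, reach (h.lifted hε hu) → good c s := by
    intro c hc s h u hu hr
    have hstep : ∀ v w, ∀ hv : IsCellCorner c v, ∀ hw : IsCellCorner c w, LatticeAdj v w →
        reach (h.lifted hε hv) → reach (h.lifted hε hw) := fun v w hv hw hvw hrv =>
      hrv.tail (h.edgeTransport hε hc hv hw hvw)
    refine ⟨h, fun w hw => ?_⟩
    have hv : IsCellCorner c (u.1, w.2) := ⟨hu.1, hu.2.1, hw.2.2⟩
    have h1 : reach (h.lifted hε hv) := by
      by_cases huw : u.2 = w.2
      · have : u = (u.1, w.2) := Prod.ext rfl huw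
        have h2 : h.lifted hε hv = h.lifted hε hu := by
          simp only [IsSectionOn.lifted, ← this]
          rfl
        rw [h2]
        exact hr
      · refine hstep _ _ hu hv (Or.inl ⟨rfl, ?_⟩) hr
        simp only [IsCellCorner] at hu hw
        dsimp only
        omega
    by_cases huw : u.1 = w.1
    · have : (u.1, w.2) = w := Prod.ext huw rfl
      have h2 : h.lifted hε hw = h.lifted hε hv := by
        simp only [IsSectionOn.lifted, this]
        rfl
      rw [h2]
      exact h1
    · refine hstep _ _ hv hw (Or.inr ⟨rfl, ?_⟩) h1
      simp only [IsCellCorner] at hu hw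
      dsimp only
      omega
  have hgood_eq : ∀ c d s t, good c s → good d t →
      EqOn s t (latticeCell ε c ∩ latticeCell ε d) := by
    rintro c d s t ⟨hs, hsr⟩ ⟨ht, htr⟩ w ⟨hwc, hwd⟩
    obtain ⟨u, hcu, hdu⟩ := exists_common_corner hε hwc hwd
    have h1 := hT.eq_of_reachable (hsr u hcu) (htr u hdu) rfl
    have h2 : s (latticePoint ε u) = t (latticePoint ε u) :=
      congrArg (fun x : LiftedPoint p ψ ε => x.1.2) h1
    have hc' := (convex_latticeCell ε c).segment_subset (latticePoint_mem_latticeCell hε hcu) hwc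
    have hd' := (convex_latticeCell ε d).segment_subset (latticePoint_mem_latticeCell hε hdu) hwd
    exact (hs.mono hc').eqOn_segment hinj (ht.mono hd') h2
  have hgood₀ : good c₀ s₀ := hgood_of c₀ (hMP hc₀M) s₀ hs₀ c₀ (hself c₀) .refl
  have hall : ∀ c ∈ M, ∃ s, good c s := by
    -- Cells of `M` with and without a good section give two closed sets that cover `K`. If both
    -- kinds occur, connectedness of `K` yields touching cells, and a good section extends across
    -- their common corner.
    by_contra! hcon
    obtain ⟨c₁, hc₁, hc₁'⟩ := hcon
    have hcl : ∀ A : Set (ℤ × ℤ), A ⊆ M → IsClosed (⋃ c ∈ A, latticeCell ε c) := fun A hA =>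
      (hMfin.subset hA).isClosed_biUnion fun c _ => isClosed_latticeCell ε c
    have hcover : K ⊆ (⋃ c ∈ {c ∈ M | ∃ s, good c s}, latticeCell ε c) ∪
        ⋃ c ∈ {c ∈ M | ¬ ∃ s, good c s}, latticeCell ε c := by
      intro w hw
      obtain ⟨c, hc⟩ := exists_mem_latticeCell hε w
      have hcM : c ∈ M := ⟨w, hc, hw⟩
      by_cases h : ∃ s, good c s
      · exact Or.inl (mem_biUnion (show c ∈ {c ∈ M | ∃ s, good c s} from ⟨hcM, h⟩) hc)
      · exact Or.inr (mem_biUnion (show c ∈ {c ∈ M | ¬ ∃ s, good c s} from ⟨hcM, h⟩) hc)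
    obtain ⟨z₁, hz₁, hz₁K⟩ := hc₁
    obtain ⟨w, -, hw1, hw2⟩ := isPreconnected_closed_iff.1 hKc _ _ (hcl _ (sep_subset _ _))
      (hcl _ (sep_subset _ _)) hcover
      ⟨w₀, hw₀, mem_biUnion (show c₀ ∈ {c ∈ M | ∃ s, good c s} from ⟨hc₀M, s₀, hgood₀⟩) hc₀⟩
      ⟨z₁, hz₁K, mem_biUnion (show c₁ ∈ {c ∈ M | ¬ ∃ s, good c s} from
        ⟨⟨z₁, hz₁, hz₁K⟩, fun ⟨s, hs⟩ => hc₁' s hs⟩) hz₁⟩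
    obtain ⟨c, ⟨hcM, s, hs, hsr⟩, hwc⟩ := mem_iUnion₂.1 hw1
    obtain ⟨d, ⟨hdM, hd⟩, hwd⟩ := mem_iUnion₂.1 hw2
    obtain ⟨u, hcu, hdu⟩ := exists_common_corner hε hwc hwd
    obtain ⟨t, ht, htu⟩ := hsecP d (hMP hdM) _ (latticePoint_mem_latticeCell hε hdu)
      (s (latticePoint ε u)) (hs.lifted hε hcu).2
    refine hd ⟨t, hgood_of d (hMP hdM) t ht u hdu ?_⟩
    have : ht.lifted hε hdu = hs.lifted hε hcu := by
      simp only [IsSectionOn.lifted, htu]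
      rfl
    rw [this]
    exact hsr u hcu
  have : Nonempty Y := ⟨y₀⟩
  choose! σ hσ using hall
  choose c hc using fun w : ℂ => exists_mem_latticeCell hε w
  have hcM : ∀ w ∈ K, c w ∈ M := fun w hw => ⟨w, hc w, hw⟩
  have heq : ∀ d s, good d s → EqOn (fun w => σ (c w) w) s (K ∩ latticeCell ε d) :=
    fun d s hs w hw => hgood_eq _ _ _ _ (hσ _ (hcM w hw.1)) hs ⟨hc w, hw.2⟩
  refine ⟨fun w => σ (c w) w, ⟨?_, fun w hw => ?_⟩, ?_⟩
  · have hK' : K = ⋃ d : M, K ∩ latticeCell ε d := by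
      rw [← inter_iUnion, eq_comm, inter_eq_left]
      exact fun w hw => mem_iUnion.2 ⟨⟨c w, hcM w hw⟩, hc w⟩
    have : Finite M := hMfin
    rw [hK']
    refine (locallyFinite_of_finite _).continuousOn_iUnion
      (fun d => hK.isClosed.inter (isClosed_latticeCell ε d)) fun d => ?_
    have hd := hσ d d.2
    exact (hd.1.1.mono inter_subset_right).congr (heq d _ hd)
  · exact (hσ _ (hcM w hw)).1.2 w (hc w)
  · rw [← hs₀w]
    exact heq c₀ s₀ hgood₀ ⟨hw₀, hc₀⟩

end Section

/-! ### A maximum principle with a countable exceptional set -/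

/-- If `w` is locally the norm of an analytic function where it exceeds `1`, then `w ^ k * ‖Q‖` is
bounded by its values on the boundary circle, provided that it is small near the exceptional
set. -/
theorem pow_mul_norm_le_of_sphere {E : Set ℂ} (hE : IsClosed E) {ρ M m : ℝ} {w : ℂ → ℝ} {k : ℕ}
    {Q : ℂ → ℂ} {O : Set ℂ} (hO : IsOpen O) (hEO : E ⊆ O)
    (hc : ∀ z ∉ E, ContinuousAt w z) (hw1 : ∀ z ∉ E, 1 ≤ w z) (hwM : ∀ z ∉ E, w z ≤ M)
    (hg : ∀ z ∉ E, 1 < w z → ∃ g : ℂ → ℂ, AnalyticAt ℂ g z ∧ ∀ᶠ ζ in 𝓝 z, w ζ = ‖g ζ‖)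
    (hm : 1 ≤ m) (hwm : ∀ z, ‖z‖ = ρ → w z ≤ m) (hQ : Differentiable ℂ Q)
    (hQ1 : ∀ z ∈ Metric.closedBall (0 : ℂ) ρ, ‖Q z‖ ≤ 1)
    (hQO : ∀ z ∈ Metric.closedBall (0 : ℂ) ρ, z ∈ O → M ^ k * ‖Q z‖ ≤ 1)
    {z : ℂ} (hz : z ∈ Metric.closedBall (0 : ℂ) ρ) (hzO : z ∉ O) : w z ^ k * ‖Q z‖ ≤ m ^ k := by
  set S : Set ℂ := Metric.closedBall (0 : ℂ) ρ \ O with hS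
  have hScomp : IsCompact S := (isCompact_closedBall _ _).diff hO
  have hSE : ∀ x ∈ S, x ∉ E := fun x hx hxE => hx.2 (hEO hxE)
  set H : ℂ → ℝ := fun z => w z ^ k * ‖Q z‖ with hH
  have hHc : ContinuousOn H S := fun x hx =>
    (((hc x (hSE x hx)).pow k).mul hQ.continuous.norm.continuousAt).continuousWithinAt
  obtain ⟨z₁, hz₁, hmax⟩ := hScomp.exists_isMaxOn ⟨z, hz, hzO⟩ hHc
  refine (hmax ⟨hz, hzO⟩).trans ?_
  change H z₁ ≤ m ^ k
  by_contra! hlt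
  have hmk : 1 ≤ m ^ k := one_le_pow₀ hm
  -- The set of maximum points is closed, and open by the maximum modulus principle: near `O` the
  -- function is at most `1`, and on the circle at most `m ^ k`, so neither interferes. A nonempty
  -- clopen compact subset of the plane is impossible.
  set T : Set ℂ := S ∩ H ⁻¹' {H z₁} with hT
  have hTclosed : IsClosed T := hHc.preimage_isClosed_of_isClosed hScomp.isClosed isClosed_singleton
  have hTopen : IsOpen T := by
    rw [isOpen_iff_mem_nhds]
    rintro x ⟨hxS, hxT⟩
    have hxT : H x = H z₁ := hxT
    have hxE := hSE x hxS
    have hw0 : 0 ≤ w x := zero_le_one.trans (hw1 x hxE)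
    have hwx : m < w x := by
      by_contra! h
      have h1 : H x ≤ m ^ k * 1 :=
        mul_le_mul (pow_le_pow_left₀ hw0 h k) (hQ1 x hxS.1) (norm_nonneg _) (by linarith)
      linarith
    have hxρ : x ∈ Metric.ball (0 : ℂ) ρ := by
      rw [mem_ball_zero_iff]
      refine lt_of_le_of_ne (by simpa using hxS.1) fun h => ?_
      exact absurd (hwm x h) (not_le.2 hwx)
    obtain ⟨g, hgx, hgw⟩ := hg x hxE (hm.trans_lt hwx)
    set G : ℂ → ℂ := fun ζ => g ζ ^ k * Q ζ with hG
    have hGH : ∀ᶠ ζ in 𝓝 x, H ζ = ‖G ζ‖ := by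
      filter_upwards [hgw] with ζ hζ
      simp only [hH, hG, hζ, norm_mul, norm_pow]
    have hnear : ∀ᶠ ζ in 𝓝 x, ζ ∈ Metric.ball (0 : ℂ) ρ ∧ ζ ∉ E :=
      (Metric.isOpen_ball.eventually_mem hxρ).and (hE.isOpen_compl.eventually_mem hxE)
    have hsmall : ∀ ζ, ζ ∈ Metric.ball (0 : ℂ) ρ → ζ ∉ E → ζ ∈ O → H ζ ≤ 1 := by
      intro ζ h1 h2 h3
      refine le_trans ?_ (hQO ζ (Metric.ball_subset_closedBall h1) h3)
      exact mul_le_mul_of_nonneg_right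
        (pow_le_pow_left₀ (zero_le_one.trans (hw1 ζ h2)) (hwM ζ h2) k) (norm_nonneg _)
    have hloc : IsLocalMax (norm ∘ G) x := by
      filter_upwards [hGH, hnear] with ζ h1 h2
      rw [Function.comp, Function.comp, ← h1, ← hGH.self_of_nhds, hxT]
      by_cases hζO : ζ ∈ O
      · linarith [hsmall ζ h2.1 h2.2 hζO]
      · exact hmax ⟨Metric.ball_subset_closedBall h2.1, hζO⟩
    have hGd : ∀ᶠ ζ in 𝓝 x, DifferentiableAt ℂ G ζ := by
      filter_upwards [hgx.eventually_analyticAt] with ζ hζ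
      exact (hζ.differentiableAt.pow k).mul (hQ ζ)
    have hconst := Complex.eventually_eq_of_isLocalMax_norm hGd hloc
    filter_upwards [hconst, hGH, hnear] with ζ h1 h2 h3
    have h4 : H ζ = H z₁ := by rw [h2, h1, ← hGH.self_of_nhds, hxT]
    refine ⟨⟨Metric.ball_subset_closedBall h3.1, fun hζO => ?_⟩, h4⟩
    linarith [hsmall ζ h3.1 h3.2 hζO]
  have hTuniv : T = univ :=
    IsClopen.eq_univ ⟨hTclosed, hTopen⟩ ⟨z₁, hz₁, rfl⟩
  have hbdd : IsCompact (univ : Set ℂ) := by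
    rw [← hTuniv]
    exact hScomp.of_isClosed_subset hTclosed inter_subset_left
  exact noncompact_univ ℂ hbdd

theorem le_of_forall_pow_mul_le {x m δ : ℝ} (hm : 0 < m) (hδ : 0 < δ)
    (h : ∀ k : ℕ, 0 < k → x ^ k * δ ≤ m ^ k) : x ≤ m := by
  by_contra! hlt
  have h1 : 1 < x / m := (one_lt_div hm).2 hlt
  obtain ⟨k, hk⟩ := pow_unbounded_of_one_lt δ⁻¹ h1
  have hk' : δ⁻¹ < (x / m) ^ (k + 1) := hk.trans_le (pow_le_pow_right₀ h1.le (Nat.le_succ k))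
  have h2 := h (k + 1) (Nat.succ_pos k)
  rw [div_pow, lt_div_iff₀ (by positivity), inv_mul_lt_iff₀ hδ] at hk'
  linarith

theorem sum_two_pow_sub_le (F : Finset ℕ) {N : ℕ} (hF : ∀ i ∈ F, i ≤ N) :
    ∑ i ∈ F, 2 ^ (N - i) ≤ 2 ^ (N + 1) := by
  calc ∑ i ∈ F, 2 ^ (N - i) ≤ ∑ i ∈ Finset.range (N + 1), 2 ^ (N - i) :=
        Finset.sum_le_sum_of_subset fun i hi => Finset.mem_range.2 (Nat.lt_succ_of_le (hF i hi))
    _ = ∑ i ∈ Finset.range (N + 1), 2 ^ i := by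
        rw [← Finset.sum_range_reflect (fun i => 2 ^ i)]
        rfl
    _ ≤ 2 ^ (N + 1) := (Nat.geomSum_lt le_rfl fun i hi => Finset.mem_range.1 hi).le

/-- Countable sets are polar. The polynomial `∏ ((x - b i) / (2ρ)) ^ 2 ^ (N - i)` plays the role of
the exponential of a potential with weights `2 ^ (-i)`: it is small near `E`, while at `z` its `2 ^
N`-th root stays above `η ^ 2` because the exponents sum to at most `2 ^ (N + 1)`. The resulting
bound `w z ^ k * η ^ 2 ≤ m ^ k` holds for all `k`, which removes `η`. -/
theorem le_of_le_sphere_of_countable {E : Set ℂ} (hE : IsCompact E) (hEc : E.Countable)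
    (hEn : E.Nonempty) {ρ M m : ℝ} (hEρ : E ⊆ Metric.ball 0 ρ) {w : ℂ → ℝ}
    (hc : ∀ z ∉ E, ContinuousAt w z) (hw1 : ∀ z ∉ E, 1 ≤ w z) (hwM : ∀ z ∉ E, w z ≤ M)
    (hg : ∀ z ∉ E, 1 < w z → ∃ g : ℂ → ℂ, AnalyticAt ℂ g z ∧ ∀ᶠ ζ in 𝓝 z, w ζ = ‖g ζ‖)
    (hm : 1 ≤ m) (hwm : ∀ z, ‖z‖ = ρ → w z ≤ m) {z : ℂ} (hz : z ∈ Metric.ball (0 : ℂ) ρ)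
    (hzE : z ∉ E) : w z ≤ m := by
  obtain ⟨b, hb⟩ := hEc.exists_eq_range hEn
  have hbE : ∀ i, b i ∈ E := fun i => hb ▸ mem_range_self i
  have hρ : 0 < ρ := (norm_nonneg z).trans_lt (by simpa using hz)
  have hM : 1 ≤ M := (hw1 z hzE).trans (hwM z hzE)
  obtain ⟨δ, hδ, hδE⟩ := Metric.isOpen_iff.1 hE.isClosed.isOpen_compl z hzE
  have hδb : ∀ i, δ ≤ ‖z - b i‖ := by
    intro i
    by_contra! h
    refine hδE ?_ (hbE i)
    rwa [Metric.mem_ball, dist_comm, dist_eq_norm]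
  have ht1 : ∀ x ∈ Metric.closedBall (0 : ℂ) ρ, ∀ i, ‖(x - b i) / (2 * ρ)‖ ≤ 1 := by
    intro x hx i
    have h1 : ‖x‖ ≤ ρ := by simpa using hx
    have h2 : ‖b i‖ < ρ := by simpa using hEρ (hbE i)
    have h3 : ‖(2 * ρ : ℂ)‖ = 2 * ρ := by
      rw [norm_mul, Complex.norm_real, Real.norm_of_nonneg hρ.le]; simp
    rw [norm_div, h3, div_le_one (by linarith)]
    linarith [norm_sub_le x (b i)]
  set η : ℝ := δ / (2 * ρ) with hη
  have hη0 : 0 < η := by positivity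
  have hηt : ∀ i, η ≤ ‖(z - b i) / (2 * ρ)‖ := by
    intro i
    have h3 : ‖(2 * ρ : ℂ)‖ = 2 * ρ := by
      rw [norm_mul, Complex.norm_real, Real.norm_of_nonneg hρ.le]; simp
    rw [norm_div, h3]
    exact div_le_div_of_nonneg_right (hδb i) (by linarith)
  have hη1 : η ≤ 1 := (hηt 0).trans (ht1 z (Metric.ball_subset_closedBall hz) 0)
  refine le_of_forall_pow_mul_le (δ := η ^ 2) (by linarith) (by positivity) fun k hk => ?_
  -- In the ball about `b i` the factor `M ^ (k * 2 ^ i)` is absorbed by `‖(x - b i) / (2 * ρ)‖`;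
  -- raising to the power `2 ^ (N - i)` gives the exponent `k * 2 ^ N` for each `i`. The bound by
  -- `δ` keeps `z` outside the balls.
  set r : ℕ → ℝ := fun i => min δ (2 * ρ / M ^ (k * 2 ^ i)) with hr
  have hr0 : ∀ i, 0 < r i := fun i => lt_min hδ (by positivity)
  obtain ⟨F, hF⟩ := hE.elim_finite_subcover (fun i => Metric.ball (b i) (r i))
    (fun i => Metric.isOpen_ball) (by
      intro x hx
      rw [hb] at hx
      obtain ⟨i, rfl⟩ := hx
      exact mem_iUnion.2 ⟨i, Metric.mem_ball_self (hr0 i)⟩)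
  obtain ⟨N, hN⟩ : ∃ N, ∀ i ∈ F, i ≤ N := ⟨F.sup id, fun i hi => Finset.le_sup (f := id) hi⟩
  have key := pow_mul_norm_le_of_sphere (k := k * 2 ^ N)
    (Q := fun x => ∏ i ∈ F, ((x - b i) / (2 * ρ)) ^ 2 ^ (N - i))
    hE.isClosed (isOpen_biUnion fun i (_ : i ∈ F) => Metric.isOpen_ball) hF hc hw1 hwM hg hm hwm
    ?_ ?_ ?_ (Metric.ball_subset_closedBall hz) ?_
  · have h1 : η ^ 2 ^ (N + 1) ≤ ‖∏ i ∈ F, ((z - b i) / (2 * ρ)) ^ 2 ^ (N - i)‖ := by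
      calc η ^ 2 ^ (N + 1) ≤ η ^ ∑ i ∈ F, 2 ^ (N - i) :=
            pow_le_pow_of_le_one hη0.le hη1 (sum_two_pow_sub_le F hN)
        _ = ∏ i ∈ F, η ^ 2 ^ (N - i) := (Finset.prod_pow_eq_pow_sum _ _ _).symm
        _ ≤ ∏ i ∈ F, ‖((z - b i) / (2 * ρ)) ^ 2 ^ (N - i)‖ := by
            refine Finset.prod_le_prod (fun i _ => by positivity) fun i _ => ?_
            rw [norm_pow]
            exact pow_le_pow_left₀ hη0.le (hηt i) _
        _ = _ := (norm_prod _ _).symm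
    have hwz : 0 ≤ w z := zero_le_one.trans (hw1 z hzE)
    have h2 : (w z ^ k * η ^ 2) ^ 2 ^ N ≤ (m ^ k) ^ 2 ^ N := by
      rw [← pow_mul m]
      refine le_trans ?_ key
      rw [mul_pow, ← pow_mul, ← pow_mul, ← pow_succ']
      exact mul_le_mul_of_nonneg_left h1 (by positivity)
    exact (pow_le_pow_iff_left₀ (by positivity) (by positivity) (by positivity)).1 h2
  · fun_prop
  · intro x hx
    rw [norm_prod]
    refine Finset.prod_le_one (fun i _ => norm_nonneg _) fun i _ => ?_
    rw [norm_pow]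
    exact pow_le_one₀ (norm_nonneg _) (ht1 x hx i)
  · intro x hx hxO
    obtain ⟨i, hi, hxi⟩ := mem_iUnion₂.1 hxO
    have h3 : ‖(2 * ρ : ℂ)‖ = 2 * ρ := by
      rw [norm_mul, Complex.norm_real, Real.norm_of_nonneg hρ.le]; simp
    have hxr : ‖x - b i‖ ≤ 2 * ρ / M ^ (k * 2 ^ i) := by
      rw [Metric.mem_ball, dist_eq_norm] at hxi
      exact hxi.le.trans (min_le_right _ _)
    have h4 : M ^ (k * 2 ^ i) * ‖(x - b i) / (2 * ρ)‖ ≤ 1 := by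
      rw [norm_div, h3, ← mul_div_assoc, div_le_one (by linarith)]
      rwa [le_div_iff₀' (by positivity)] at hxr
    have h5 : ‖∏ i ∈ F, ((x - b i) / (2 * ρ)) ^ 2 ^ (N - i)‖ ≤
        ‖(x - b i) / (2 * ρ)‖ ^ 2 ^ (N - i) := by
      rw [norm_prod, ← Finset.mul_prod_erase _ _ hi, norm_pow]
      refine mul_le_of_le_one_right (by positivity) ?_
      refine Finset.prod_le_one (fun i _ => norm_nonneg _) fun j _ => ?_
      rw [norm_pow]
      exact pow_le_one₀ (norm_nonneg _) (ht1 x hx j)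
    have h6 : M ^ (k * 2 ^ N) = (M ^ (k * 2 ^ i)) ^ 2 ^ (N - i) := by
      rw [← pow_mul, mul_assoc, ← pow_add, Nat.add_sub_cancel' (hN i hi)]
    calc _ ≤ M ^ (k * 2 ^ N) * ‖(x - b i) / (2 * ρ)‖ ^ 2 ^ (N - i) :=
          mul_le_mul_of_nonneg_left h5 (by positivity)
      _ = (M ^ (k * 2 ^ i) * ‖(x - b i) / (2 * ρ)‖) ^ 2 ^ (N - i) := by rw [h6, mul_pow]
      _ ≤ 1 := pow_le_one₀ (by positivity) h4
  · intro hzO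
    obtain ⟨i, hi, hzi⟩ := mem_iUnion₂.1 hzO
    rw [Metric.mem_ball, dist_eq_norm] at hzi
    linarith [hδb i, min_le_left δ (2 * ρ / M ^ (k * 2 ^ i))]

/-- A bounded continuous function off a countable compact subset of the sphere, at least `1`, that
is locally the norm of an analytic function where it exceeds `1`, attains its maximum. -/
theorem Sphere.exists_max_of_countable {B : Set Sphere} (hB : IsCompact B) (hBc : B.Countable)
    (hBn : B.Nonempty) {M : ℝ} {w : Sphere → ℝ} (hc : ∀ z ∉ B, ContinuousAt w z)
    (hw1 : ∀ z ∉ B, 1 ≤ w z) (hwM : ∀ z ∉ B, w z ≤ M)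
    (hg : ∀ z ∉ B, 1 < w z → ∃ g : ℂ → ℂ, AnalyticAt ℂ g (coord z z) ∧
      ∀ᶠ ζ in 𝓝 (coord z z), w (param z ζ) = ‖g ζ‖) :
    ∃ z₁ ∉ B, ∀ z ∉ B, w z ≤ w z₁ := by
  obtain ⟨e, he⟩ := exists_coe_notMem_of_countable hBc
  have hμ := isOpenEmbedding_chart e
  have hBr : B ⊆ range (chart e) := by
    rw [range_chart]
    exact fun x hx hxe => he (hxe ▸ hx)
  set E : Set ℂ := chart e ⁻¹' B with hE
  have hEcomp : IsCompact E := hμ.isInducing.isCompact_preimage' hB hBr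
  obtain ⟨ρ, hρ, hEρ⟩ := hEcomp.isBounded.subset_ball_lt 0 0
  -- `S` is compact, disjoint from `B`, and contains the image of the circle of radius `ρ`. So the
  -- maximum over `S` also bounds `w` inside the disc.
  set S : Set Sphere := (chart e '' Metric.ball 0 ρ)ᶜ with hS
  have hScomp : IsCompact S := (hμ.isOpenMap _ Metric.isOpen_ball).isClosed_compl.isCompact
  have hSB : ∀ x ∈ S, x ∉ B := by
    intro x hx hxB
    obtain ⟨z, rfl⟩ := hBr hxB
    exact hx ⟨z, hEρ hxB, rfl⟩
  have heS : (e : Sphere) ∈ S := by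
    rintro ⟨z, -, hz⟩
    have : (e : Sphere) ∈ range (chart e) := ⟨z, hz⟩
    rw [range_chart] at this
    exact this rfl
  obtain ⟨z₁, hz₁, hmax⟩ := hScomp.exists_isMaxOn ⟨_, heS⟩
    (fun x hx => (hc x (hSB x hx)).continuousWithinAt)
  refine ⟨z₁, hSB z₁ hz₁, fun x hx => ?_⟩
  by_cases hxS : x ∈ S
  · exact hmax hxS
  obtain ⟨z, hz, rfl⟩ := not_not.1 hxS
  refine le_of_le_sphere_of_countable (w := fun ζ => w (chart e ζ)) hEcomp
    (hBc.preimage hμ.injective) ?_ hEρ ?_ (fun ζ hζ => hw1 _ hζ) (fun ζ hζ => hwM _ hζ) ?_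
    (hw1 z₁ (hSB z₁ hz₁)) ?_ hz hx
  · obtain ⟨y, hy⟩ := hBn
    obtain ⟨z, rfl⟩ := hBr hy
    exact ⟨z, hy⟩
  · intro ζ hζ
    exact (hc _ hζ).comp hμ.continuous.continuousAt
  · intro ζ hζ hwζ
    obtain ⟨g, hga, hgw⟩ := hg _ hζ hwζ
    have ha := analyticAt_coord_chart e ζ
    refine ⟨fun x => g (coord (chart e ζ) (chart e x)), AnalyticAt.fun_comp hga ha, ?_⟩
    have h1 : ∀ᶠ x in 𝓝 ζ, chart e x ∈ range (param (chart e ζ)) :=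
      hμ.continuous.continuousAt.eventually_mem (range_param_mem_nhds _)
    filter_upwards [h1, ha.continuousAt.eventually hgw] with x hx1 hx2
    rw [← hx2, param_coord hx1]
  · intro ζ hζ
    refine hmax ?_
    rintro ⟨x, hx, hxζ⟩
    rw [hμ.injective hxζ, mem_ball_zero_iff] at hx
    exact hx.ne hζ

/-! ### Density of the image of a component of the preimage -/

theorem tendsto_comp_param {z : Sphere} (hz : ContinuousAt f z) :
    ContinuousAt (fun ζ => f (Sphere.param z ζ)) (Sphere.coord z z) := by
  refine ContinuousAt.comp ?_ (Sphere.isOpenEmbedding_param z).continuous.continuousAt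
  rwa [Sphere.param_coord_self]

theorem Sphere.eventually_nhds_iff_param {z : Sphere} {p : Sphere → Prop} :
    (∀ᶠ x in 𝓝 z, p x) ↔ ∀ᶠ ζ in 𝓝 (coord z z), p (param z ζ) := by
  have h := (isOpenEmbedding_param z).map_nhds_eq (coord z z)
  rw [param_coord_self] at h
  rw [← h, eventually_map]

/-- A function of the class `K` is not locally constant at any point of its domain. -/
theorem IsClassK.not_eventually_const (hf : IsClassK B f) {z₁ : Sphere} (hz₁ : z₁ ∉ B)
    (c : Sphere) : ¬ ∀ᶠ x in 𝓝 z₁, f x = c := by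
  intro hconst
  set T : Set Sphere := {z | ∀ᶠ x in 𝓝 z, f x = c} with hT
  have hTo : IsOpen T := isOpen_iff_mem_nhds.2 fun z hz => eventually_eventually_nhds.2 hz
  have hTc : ∀ z ∈ T, f z = c := fun z hz =>
    Eventually.self_of_nhds (p := fun x => f x = c) hz
  have hsub : Bᶜ ⊆ T := by
    refine (Sphere.isConnected_compl_of_countable hf.countable).isPreconnected
      |>.subset_of_closure_inter_subset hTo ⟨z₁, hz₁, hconst⟩ ?_
    rintro z ⟨hzT, hzB⟩
    by_contra hznT
    have hmer := hf.meromorphic z hzB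
    have hfz : f z = c := by
      by_contra hne
      obtain ⟨x, hx, hxT⟩ := mem_closure_iff_nhds.1 hzT _ (hmer.1.eventually_ne hne)
      exact hx (hTc x hxT)
    have hfreq : ∃ᶠ ζ in 𝓝[≠] (Sphere.coord z z),
        localRep f z ζ = Sphere.coord (f z) (f z) := by
      rw [frequently_iff]
      intro W hW
      obtain ⟨W', hW', hWW'⟩ := mem_nhdsWithin_iff_exists_mem_nhds_inter.1 hW
      have h1 := (Sphere.isOpenEmbedding_param z).image_mem_nhds.2 hW'
      rw [Sphere.param_coord_self] at h1
      obtain ⟨x, ⟨ζ, hζ, rfl⟩, hxT⟩ := mem_closure_iff_nhds.1 hzT _ h1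
      refine ⟨ζ, hWW' ⟨hζ, fun h => ?_⟩, ?_⟩
      · rw [mem_singleton_iff] at h
        rw [h, Sphere.param_coord_self] at hxT
        exact hznT hxT
      · rw [localRep, hTc _ hxT, hfz]
    have hev := (hmer.2.frequently_eq_iff_eventually_eq analyticAt_const).1 hfreq
    refine hznT ?_
    change ∀ᶠ x in 𝓝 z, f x = c
    rw [Sphere.eventually_nhds_iff_param]
    have hr := (tendsto_comp_param hmer.1).eventually_mem
      (s := range (Sphere.param (f z))) (by
        rw [Sphere.param_coord_self]; exact Sphere.range_param_mem_nhds _)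
    filter_upwards [hev, hr] with ζ h1 h2
    rw [← Sphere.param_coord h2, ← hfz]
    rw [localRep] at h1
    rw [h1, Sphere.param_coord_self]
  exact hf.nonconstant ⟨c, fun z hz => hTc z (hsub hz)⟩

/-- The distance to `c` in the coordinate at `a`, truncated at `R`. -/
noncomputable def truncDist (a : Sphere) (c : ℂ) (R : ℝ) (q : Sphere) : ℝ :=
  open Classical in
  if q ∈ range (Sphere.param a) then min R ‖Sphere.coord a q - c‖ else R

theorem truncDist_eq_of_notMem {a : Sphere} {c : ℂ} {R : ℝ} {q : Sphere}
    (hq : q ∉ Sphere.param a '' Metric.closedBall c R) : truncDist a c R q = R := by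
  rw [truncDist]
  split_ifs with h
  · refine min_eq_left ?_
    by_contra! hlt
    refine hq ⟨Sphere.coord a q, ?_, Sphere.param_coord h⟩
    rw [Metric.mem_closedBall, dist_eq_norm]
    exact hlt.le
  · rfl

theorem isClosed_param_image_closedBall (a : Sphere) (c : ℂ) (R : ℝ) :
    IsClosed (Sphere.param a '' Metric.closedBall c R) :=
  ((isCompact_closedBall c R).image (Sphere.isOpenEmbedding_param a).continuous).isClosed

theorem continuous_truncDist (a : Sphere) (c : ℂ) (R : ℝ) : Continuous (truncDist a c R) := by
  rw [continuous_iff_continuousAt]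
  intro q
  by_cases hq : q ∈ range (Sphere.param a)
  · have h1 : ContinuousAt (fun q => min R ‖Sphere.coord a q - c‖) q :=
      continuousAt_const.min ((Sphere.continuousAt_coord hq).sub continuousAt_const).norm
    refine h1.congr ?_
    filter_upwards [(Sphere.isOpenEmbedding_param a).isOpen_range.mem_nhds hq] with x hx
    rw [truncDist, if_pos hx]
  · have h1 : q ∉ Sphere.param a '' Metric.closedBall c R := fun h => hq (image_subset_range _ _ h)
    refine continuousAt_const.congr (f := fun _ => R) ?_
    filter_upwards [(isClosed_param_image_closedBall a c R).isOpen_compl.mem_nhds h1] with x hx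
    exact (truncDist_eq_of_notMem hx).symm

theorem truncDist_le (a : Sphere) (c : ℂ) (R : ℝ) (q : Sphere) : truncDist a c R q ≤ R := by
  rw [truncDist]
  split_ifs
  · exact min_le_left _ _
  · exact le_rfl

theorem truncDist_lt_iff {a : Sphere} {c : ℂ} {R : ℝ} {q : Sphere} :
    truncDist a c R q < R ↔ q ∈ range (Sphere.param a) ∧ ‖Sphere.coord a q - c‖ < R := by
  rw [truncDist]
  split_ifs with h <;> simp [h]

theorem truncDist_of_lt {a : Sphere} {c : ℂ} {R : ℝ} {q : Sphere} (h : truncDist a c R q < R) :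
    truncDist a c R q = ‖Sphere.coord a q - c‖ := by
  obtain ⟨h1, h2⟩ := truncDist_lt_iff.1 h
  rw [truncDist, if_pos h1, min_eq_right h2.le]

/-- The image of a component of the preimage of a domain `U` is dense in `U`. -/
theorem IsClassK.subset_closure_image (hf : IsClassK B f) {U : Set Sphere} (hU : IsOpen U)
    (hUc : IsPreconnected U) {V : Set Sphere} (hV : IsComponentOf V (Bᶜ ∩ f ⁻¹' U)) :
    U ⊆ closure (f '' V) := by
  classical
  obtain ⟨z₀, hz₀, rfl⟩ := hV
  set O : Set Sphere := Bᶜ ∩ f ⁻¹' U with hO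
  have hOo : IsOpen O := isOpen_compl_inter_preimage hf.compact hf.meromorphic hU
  set V : Set Sphere := connectedComponentIn O z₀ with hV
  have hVo : IsOpen V := hOo.connectedComponentIn
  have hVO : V ⊆ O := connectedComponentIn_subset _ _
  have hz₀V : z₀ ∈ V := mem_connectedComponentIn hz₀
  by_contra hcon
  -- By connectedness of `U`, some frontier point `a` of the closure of `f(V)` lies in `U`. A point
  -- `c` off this closure is taken so near to `a` that a disc about `c` contains `a` and lies in
  -- `U`.
  obtain ⟨a, haU, hacl, haW⟩ : ∃ a ∈ U, a ∈ closure (closure (f '' V))ᶜ ∧ a ∈ closure (f '' V) := by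
    by_contra! h
    have h1 : U ⊆ (closure (f '' V))ᶜ := by
      refine hUc.subset_of_closure_inter_subset isClosed_closure.isOpen_compl ?_
        fun x hx => h x hx.2 hx.1
      obtain ⟨x, hxU, hx⟩ := not_subset.1 hcon
      exact ⟨x, hxU, hx⟩
    exact h1 hz₀.2 (subset_closure ⟨z₀, hz₀V, rfl⟩)
  have hA := Sphere.isOpenEmbedding_param a
  obtain ⟨ρ, hρ, hρU⟩ := Metric.isOpen_iff.1 (hU.preimage hA.continuous) (Sphere.coord a a)
    (by rwa [mem_preimage, Sphere.param_coord_self])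
  have hnhds : ∀ O : Set ℂ, IsOpen O → Sphere.coord a a ∈ O → Sphere.param a '' O ∈ 𝓝 a :=
    fun O hO hOm => (hA.isOpenMap _ hO).mem_nhds ⟨_, hOm, Sphere.param_coord_self a⟩
  obtain ⟨_, ⟨c, hc, rfl⟩, hcW⟩ := mem_closure_iff_nhds.1 hacl _
    (hnhds _ Metric.isOpen_ball (Metric.mem_ball_self (show 0 < ρ / 4 by linarith)))
  rw [Metric.mem_ball] at hc
  set R : ℝ := ρ / 2 with hR
  have hR0 : 0 < R := by positivity
  have hballU : Sphere.param a '' Metric.closedBall c R ⊆ U := by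
    rintro _ ⟨x, hx, rfl⟩
    refine hρU ?_
    rw [Metric.mem_closedBall] at hx
    rw [Metric.mem_ball]
    linarith [dist_triangle x c (Sphere.coord a a)]
  obtain ⟨r₀, hr₀, hr₀W⟩ := Metric.isOpen_iff.1
    (isClosed_closure.isOpen_compl.preimage hA.continuous) c hcW
  set r : ℝ := min r₀ R with hr
  have hr0 : 0 < r := lt_min hr₀ hR0
  have hdr : ∀ v ∈ V, r ≤ truncDist a c R (f v) := by
    intro v hv
    by_contra! hlt
    have hltR : truncDist a c R (f v) < R := hlt.trans_le (min_le_right _ _)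
    obtain ⟨h1, -⟩ := truncDist_lt_iff.1 hltR
    rw [truncDist_of_lt hltR] at hlt
    have h2 : Sphere.coord a (f v) ∈ Metric.ball c r₀ := by
      rw [Metric.mem_ball, dist_eq_norm]
      exact hlt.trans_le (min_le_left _ _)
    have h3 := hr₀W h2
    rw [mem_preimage, Sphere.param_coord h1] at h3
    exact h3 (subset_closure ⟨v, hv, rfl⟩)
  obtain ⟨_, ⟨ζ₀, hζ₀, hζv⟩, v₀, hv₀, rfl⟩ := mem_closure_iff_nhds.1 haW _
    (hnhds _ Metric.isOpen_ball (show Sphere.coord a a ∈ Metric.ball c R by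
      rw [Metric.mem_ball, dist_comm]; linarith))
  -- `w` is `max 1 (R / |f - c|)` on `V`, extended by `1`. It is continuous off `B` because `f`
  -- takes values outside `U`, hence outside the disc, at the boundary points of `V` not in `B`; it
  -- is bounded because `f(V)` stays at distance at least `r` from `c`.
  set w : Sphere → ℝ := fun z => if z ∈ V then R / truncDist a c R (f z) else 1 with hw
  have hwV : ∀ z ∈ V, w z = R / truncDist a c R (f z) := fun z hz => if_pos hz
  have hwV' : ∀ z ∉ V, w z = 1 := fun z hz => if_neg hz
  have hw1 : ∀ z, 1 ≤ w z := by
    intro z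
    by_cases hz : z ∈ V
    · rw [hwV z hz, one_le_div (hr0.trans_le (hdr z hz))]
      exact truncDist_le _ _ _ _
    · rw [hwV' z hz]
  have hwM : ∀ z, w z ≤ R / r := by
    intro z
    by_cases hz : z ∈ V
    · rw [hwV z hz]
      exact div_le_div_of_nonneg_left hR0.le hr0 (hdr z hz)
    · rw [hwV' z hz, one_le_div hr0]
      exact min_le_right _ _
  have hwc : ∀ z ∉ B, ContinuousAt w z := by
    intro z hz
    by_cases hzV : z ∈ V
    · have h1 : ContinuousAt (fun z => R / truncDist a c R (f z)) z := by
        refine continuousAt_const.div ?_ (hr0.trans_le (hdr z hzV)).ne'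
        exact (continuous_truncDist a c R).continuousAt.comp (hf.meromorphic z hz).1
      refine h1.congr ?_
      filter_upwards [hVo.mem_nhds hzV] with x hx
      exact (hwV x hx).symm
    · refine continuousAt_const.congr (f := fun _ => (1 : ℝ)) ?_
      by_cases hzU : f z ∈ U
      · have hzO : z ∈ O := ⟨hz, hzU⟩
        filter_upwards [(hOo.connectedComponentIn (x := z)).mem_nhds
          (mem_connectedComponentIn hzO)] with x hx
        refine (hwV' x fun hxV => hzV ?_).symm
        rw [hV, connectedComponentIn_eq hxV, ← connectedComponentIn_eq hx]
        exact mem_connectedComponentIn hzO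
      · have h1 : ∀ᶠ x in 𝓝 z, f x ∈ (Sphere.param a '' Metric.closedBall c R)ᶜ :=
          (hf.meromorphic z hz).1.eventually_mem
            ((isClosed_param_image_closedBall a c R).isOpen_compl.mem_nhds
              fun h => hzU (hballU h))
        filter_upwards [h1] with x hx
        by_cases hxV : x ∈ V
        · rw [hwV x hxV, truncDist_eq_of_notMem hx, div_self hR0.ne']
        · rw [hwV' x hxV]
  have hlocal : ∀ z ∉ B, 1 < w z → z ∈ V ∧
      AnalyticAt ℂ (fun ζ => (R : ℂ) / (Sphere.coord a (f (Sphere.param z ζ)) - c))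
        (Sphere.coord z z) ∧
      (∀ᶠ ζ in 𝓝 (Sphere.coord z z), f (Sphere.param z ζ) ∈ range (Sphere.param a)) ∧
      ∀ᶠ ζ in 𝓝 (Sphere.coord z z), w (Sphere.param z ζ) =
        ‖(R : ℂ) / (Sphere.coord a (f (Sphere.param z ζ)) - c)‖ := by
    intro z hz hwz
    have hzV : z ∈ V := by
      by_contra h
      rw [hwV' z h] at hwz
      exact lt_irrefl _ hwz
    have hd0 := hr0.trans_le (hdr z hzV)
    have hdR : truncDist a c R (f z) < R := by
      rwa [hwV z hzV, one_lt_div hd0] at hwz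
    obtain ⟨h1, h2⟩ := truncDist_lt_iff.1 hdR
    rw [truncDist_of_lt hdR] at hd0
    have hmer := hf.meromorphic z hz
    have hcont := tendsto_comp_param hmer.1
    have hev : ∀ᶠ x in 𝓝 z, truncDist a c R (f x) < R ∧ x ∈ V :=
      (((continuous_truncDist a c R).continuousAt.comp hmer.1).eventually_lt_const hdR).and
        (hVo.eventually_mem hzV)
    rw [Sphere.eventually_nhds_iff_param] at hev
    refine ⟨hzV, ?_, ?_, ?_⟩
    · refine analyticAt_const.div ((coord_comp_analyticAt hmer h1).sub analyticAt_const) ?_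
      rw [Sphere.param_coord_self]
      exact norm_pos_iff.1 hd0
    · filter_upwards [hev] with ζ hζ
      exact (truncDist_lt_iff.1 hζ.1).1
    · filter_upwards [hev] with ζ hζ
      rw [hwV _ hζ.2, truncDist_of_lt hζ.1, norm_div, Complex.norm_real, Real.norm_of_nonneg hR0.le]
  obtain ⟨z₁, hz₁, hmax⟩ := Sphere.exists_max_of_countable hf.compact hf.countable hf.nonempty hwc
    (fun z _ => hw1 z) (fun z _ => hwM z)
    fun z hz hwz => ⟨_, (hlocal z hz hwz).2.1, (hlocal z hz hwz).2.2.2⟩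
  have hwv₀ : 1 < w v₀ := by
    rw [hwV v₀ hv₀, one_lt_div (hr0.trans_le (hdr v₀ hv₀)), truncDist_lt_iff, ← hζv,
      Sphere.coord_param, ← dist_eq_norm]
    exact ⟨mem_range_self _, hζ₀⟩
  have hwz₁ : 1 < w z₁ := hwv₀.trans_le (hmax v₀ (hVO hv₀).1)
  obtain ⟨hz₁V, hg, hrange, hwg⟩ := hlocal z₁ hz₁ hwz₁
  set g : ℂ → ℂ := fun ζ => (R : ℂ) / (Sphere.coord a (f (Sphere.param z₁ ζ)) - c) with hgdef
  have hBev : ∀ᶠ ζ in 𝓝 (Sphere.coord z₁ z₁), Sphere.param z₁ ζ ∉ B :=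
    Sphere.eventually_nhds_iff_param.1 (hf.compact.isClosed.isOpen_compl.eventually_mem hz₁)
  have hloc : IsLocalMax (norm ∘ g) (Sphere.coord z₁ z₁) := by
    filter_upwards [hwg, hBev] with ζ h1 h2
    rw [Function.comp, Function.comp, ← h1, ← hwg.self_of_nhds, Sphere.param_coord_self]
    exact hmax _ h2
  -- The maximum exceeds `1`, so near `z₁` the function `w` is the norm of `R / (f - c)`, which must
  -- be constant there.
  have hconst := Complex.eventually_eq_of_isLocalMax_norm
    (hg.eventually_analyticAt.mono fun ζ h => h.differentiableAt) hloc
  refine hf.not_eventually_const hz₁ (f z₁) ?_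
  rw [Sphere.eventually_nhds_iff_param]
  have hr1 := hrange.self_of_nhds
  rw [Sphere.param_coord_self] at hr1
  filter_upwards [hconst, hrange] with ζ h1 h2
  simp only [hgdef, Sphere.param_coord_self] at h1
  have hRne : (R : ℂ) ≠ 0 := by exact_mod_cast hR0.ne'
  rw [div_eq_mul_inv, div_eq_mul_inv, mul_right_inj' hRne, inv_inj, sub_left_inj] at h1
  rw [← Sphere.param_coord h2, h1, Sphere.param_coord hr1]

/-! ### Regions bounded by a curve, sections over them, and fibres over regular values -/

/-- A small punctured disc about `e` is connected, so it lies on one side of any separation of `E ∖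
{e}`; adding the disc to that side would separate `E`. -/
theorem Sphere.isPreconnected_diff_singleton {E : Set Sphere} (hEo : IsOpen E)
    (hE : IsPreconnected E) (e : ℂ) : IsPreconnected (E \ {(e : Sphere)}) := by
  by_cases he : (e : Sphere) ∈ E
  swap
  · rwa [sdiff_singleton_eq_self he]
  obtain ⟨r, hr, hrE⟩ := Metric.isOpen_iff.1 (hEo.preimage OnePoint.continuous_coe) e he
  set φ := OpenPartialHomeomorph.univBall e r with hφ
  have hφc : Continuous φ := OpenPartialHomeomorph.continuous_univBall e r
  have htarget : φ.target = Metric.ball e r := OpenPartialHomeomorph.univBall_target e hr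
  have hsource : φ.source = univ := OpenPartialHomeomorph.univBall_source e r
  have hφ0 : φ 0 = e := OpenPartialHomeomorph.univBall_apply_zero e r
  set D : Set Sphere := ((↑) : ℂ → Sphere) '' Metric.ball e r with hD
  have hDo : IsOpen D := OnePoint.isOpenMap_coe _ Metric.isOpen_ball
  have hDE : D ⊆ E := image_subset_iff.2 hrE
  have heD : (e : Sphere) ∈ D := ⟨e, Metric.mem_ball_self hr, rfl⟩
  have hD' : IsPreconnected (D \ {(e : Sphere)}) := by
    have h1 : IsPreconnected ((fun z => ((φ z : ℂ) : Sphere)) '' {0}ᶜ) :=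
      (isConnected_compl_singleton_of_one_lt_rank (by simp) (0 : ℂ)).isPreconnected.image _
        (OnePoint.continuous_coe.comp hφc).continuousOn
    convert h1 using 1
    ext x
    constructor
    · rintro ⟨⟨z, hz, rfl⟩, hze⟩
      rw [← htarget] at hz
      refine ⟨φ.symm z, fun h => hze ?_, ?_⟩
      · rw [mem_singleton_iff] at h
        rw [mem_singleton_iff, ← φ.right_inv hz, h, hφ0]
      · simp only [φ.right_inv hz]
    · rintro ⟨z, hz, rfl⟩
      have hzs : z ∈ φ.source := hsource ▸ mem_univ z
      have h0s : (0 : ℂ) ∈ φ.source := hsource ▸ mem_univ 0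
      refine ⟨⟨φ z, htarget ▸ φ.map_source hzs, rfl⟩, fun h => hz ?_⟩
      rw [mem_singleton_iff, OnePoint.coe_eq_coe, ← hφ0] at h
      exact φ.injOn hzs h0s h
  rw [isPreconnected_iff_subset_of_disjoint]
  have key : ∀ u v : Set Sphere, IsOpen u → IsOpen v → E \ {(e : Sphere)} ⊆ u ∪ v →
      E \ {(e : Sphere)} ∩ (u ∩ v) = ∅ → D \ {(e : Sphere)} ⊆ u → E \ {(e : Sphere)} ⊆ u := by
    intro u v hu hv huv hd hDu
    have h1 := isPreconnected_iff_subset_of_disjoint.1 hE (u ∪ D) (v \ {(e : Sphere)})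
      (hu.union hDo) (hv.sdiff isClosed_singleton) ?_ ?_
    · rcases h1 with h1 | h1
      · rintro x ⟨hx, hxe⟩
        exact (h1 hx).elim id fun hxD => hDu ⟨hxD, hxe⟩
      · exact absurd rfl (h1 he).2
    · intro x hx
      by_cases hxe : x = e
      · exact Or.inl (Or.inr (hxe ▸ heD))
      · exact (huv ⟨hx, hxe⟩).imp Or.inl fun h => ⟨h, hxe⟩
    · rw [eq_empty_iff_forall_notMem] at hd ⊢
      rintro x ⟨hx, hxu, hxv, hxe⟩
      exact hd x ⟨⟨hx, hxe⟩, hxu.elim id fun hxD => hDu ⟨hxD, hxe⟩, hxv⟩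
  intro u v hu hv huv hd
  have hsub : D \ {(e : Sphere)} ⊆ E \ {(e : Sphere)} := sdiff_subset_sdiff_left hDE
  rcases isPreconnected_iff_subset_of_disjoint.1 hD' u v hu hv (hsub.trans huv)
    (subset_eq_empty (inter_subset_inter_left _ hsub) hd) with h | h
  · exact Or.inl (key u v hu hv huv hd h)
  · exact Or.inr (key v u hv hu (by rwa [union_comm]) (by rwa [inter_comm v]) h)

/-- The closed region bounded by a connected set is connected. -/
theorem IsRegionBoundedBy.isPreconnected {Δ : Set Sphere} {γ : Circle → Sphere}
    (hΔ : IsRegionBoundedBy Δ γ) (hγ : Continuous γ) : IsPreconnected Δ := by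
  obtain ⟨E, ⟨z, hz, rfl⟩, rfl⟩ := hΔ
  set E : Set Sphere := connectedComponentIn (range γ)ᶜ z with hE
  have hγcl : IsClosed (range γ) := (isCompact_range hγ).isClosed
  have hγE : range γ ⊆ Eᶜ := fun x hx hxE => connectedComponentIn_subset _ _ hxE hx
  have hγc : IsPreconnected (range γ) := (isConnected_range hγ).isPreconnected
  refine isPreconnected_of_forall (γ 1) fun y hy => ?_
  by_cases hyγ : y ∈ range γ
  · exact ⟨range γ, hγE, mem_range_self _, hyγ, hγc⟩
  -- The closure of any other component adds only points of the curve, and it does add some, as the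
  -- component would otherwise be clopen in the sphere. So it is attached to the connected curve
  -- within the region.
  set C : Set Sphere := connectedComponentIn (range γ)ᶜ y with hC
  have hyC : y ∈ C := mem_connectedComponentIn hyγ
  have hCo : IsOpen C := hγcl.isOpen_compl.connectedComponentIn
  have hCsub : C ⊆ (range γ)ᶜ := connectedComponentIn_subset _ _
  have hclC : closure C ⊆ C ∪ range γ := by
    intro x hx
    by_contra hxn
    rw [mem_union, not_or] at hxn
    have hxo : connectedComponentIn (range γ)ᶜ x ∈ 𝓝 x :=
      hγcl.isOpen_compl.connectedComponentIn.mem_nhds (mem_connectedComponentIn hxn.2)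
    obtain ⟨u, hu, huC⟩ := mem_closure_iff_nhds.1 hx _ hxo
    refine hxn.1 ?_
    rw [hC, connectedComponentIn_eq huC, ← connectedComponentIn_eq hu]
    exact mem_connectedComponentIn hxn.2
  have hCE : C ⊆ Eᶜ := by
    intro x hx hxE
    refine hy ?_
    rw [hE, connectedComponentIn_eq hxE, ← connectedComponentIn_eq hx]
    exact mem_connectedComponentIn hyγ
  have hmeet : (closure C ∩ range γ).Nonempty := by
    by_contra hne
    have hCcl : IsClosed C := by
      refine isClosed_of_closure_subset fun x hx => (hclC hx).resolve_right fun h => ?_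
      exact hne ⟨x, hx, h⟩
    have huniv := IsClopen.eq_univ ⟨hCcl, hCo⟩ ⟨y, hyC⟩
    exact hCsub (huniv ▸ mem_univ (γ 1)) (mem_range_self 1)
  obtain ⟨x, hxC, hxγ⟩ := hmeet
  refine ⟨closure C ∪ range γ, ?_, Or.inr (mem_range_self _), Or.inl (subset_closure hyC),
    IsPreconnected.union x hxC hxγ isPreconnected_connectedComponentIn.closure hγc⟩
  exact union_subset (hclC.trans (union_subset hCE hγE)) hγE

/-- Over a region that contains no singular values, `f` has a continuous section through each
given point. -/
theorem exists_section_of_region (hf : IsClassK B f) {Δ : Set Sphere} {γ : Circle → Sphere}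
    (hγ : Continuous γ) (hΔ : IsRegionBoundedBy Δ γ) (hΔS : Δ ∩ singularValues B f = ∅)
    (y₀ : regularDomain B f) (hy₀ : regularMap B f y₀ ∈ Δ) :
    ∃ s : Sphere → regularDomain B f, ContinuousOn s Δ ∧ s (regularMap B f y₀) = y₀ ∧
      ∀ w ∈ Δ, regularMap B f (s w) = w := by
  have hconn := hΔ.isPreconnected hγ
  obtain ⟨E, ⟨z, hz, rfl⟩, rfl⟩ := hΔ
  set E : Set Sphere := connectedComponentIn (range γ)ᶜ z with hE
  have hEo : IsOpen E := (isCompact_range hγ).isClosed.isOpen_compl.connectedComponentIn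
  -- A point of the exterior is sent to infinity: the region becomes compact in the plane, and its
  -- complement there is the exterior without `e`, still connected.
  obtain ⟨e, he⟩ := Sphere.exists_coe_mem_of_isOpen hEo ⟨z, mem_connectedComponentIn hz⟩
  have hμ := Sphere.isOpenEmbedding_chart e
  have hsub : Eᶜ ⊆ range (Sphere.chart e) := by
    rw [Sphere.range_chart]
    exact fun x hx hxe => hx (hxe ▸ he)
  set K : Set ℂ := Sphere.chart e ⁻¹' Eᶜ with hK
  have himK : Sphere.chart e '' K = Eᶜ := image_preimage_eq_of_subset hsub
  have hKcomp : IsCompact K := hμ.isInducing.isCompact_preimage' hEo.isClosed_compl.isCompact hsub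
  have hKpre : IsPreconnected K := by
    rw [← hμ.isInducing.isPreconnected_image, himK]
    exact hconn
  have hKcpre : IsPreconnected Kᶜ := by
    rw [← hμ.isInducing.isPreconnected_image]
    have h1 : Sphere.chart e '' Kᶜ = E \ {(e : Sphere)} := by
      rw [hK, ← preimage_compl, compl_compl, image_preimage_eq_inter_range, Sphere.range_chart]
      rfl
    rw [h1]
    exact Sphere.isPreconnected_diff_singleton hEo isPreconnected_connectedComponentIn _
  set N : Set ℂ := Sphere.chart e ⁻¹' (singularValues B f)ᶜ with hN
  have hNo : IsOpen N := isClosed_closure.isOpen_compl.preimage hμ.continuous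
  have hKN : K ⊆ N := fun w hw hwS => by
    have : Sphere.chart e w ∈ (∅ : Set Sphere) := hΔS ▸ ⟨hw, hwS⟩
    exact this
  obtain ⟨w₀, hw₀⟩ := hsub hy₀
  obtain ⟨s, hs, hsw₀⟩ := exists_section_of_isPreconnected_compl (p := regularMap B f)
    (ψ := Sphere.chart e) (isLocalHomeomorph_regularMap hf) hNo
    (fun D hDN hD w hw y hy => by
      obtain ⟨s, h1, h2, h3⟩ := exists_section_of_convex hf hμ.continuous hD (fun x hx => hDN hx) hw hy
      exact ⟨s, ⟨h1, h3⟩, h2⟩)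
    hKcomp hKN hKpre hKcpre (w₀ := w₀) (by rw [hK, mem_preimage, hw₀]; exact hy₀) hw₀.symm
  have hinv : ∀ w, Function.invFun (Sphere.chart e) (Sphere.chart e w) = w :=
    Function.leftInverse_invFun hμ.injective
  refine ⟨fun q => s (Function.invFun (Sphere.chart e) q), ?_, ?_, ?_⟩
  · rw [← himK]
    rintro _ ⟨w, hw, rfl⟩
    have h1 := hs.1 w hw
    rw [ContinuousWithinAt, (hμ.isInducing.map_nhdsWithin_eq K w).symm, tendsto_map'_iff]
    simp only [hinv]
    exact Tendsto.congr (fun x => by simp only [Function.comp, hinv]) h1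
  · rw [← hw₀]
    simp only [hinv]
    exact hsw₀
  · intro q hq
    obtain ⟨w, rfl⟩ := hsub hq
    simp only [hinv]
    exact hs.2 w hq

/-- The image of a section over a set of points where it is defined nearby is open. -/
theorem isOpen_image_of_section {Y X : Type*} [TopologicalSpace Y] [TopologicalSpace X]
    {p : Y → X} (hp : IsLocalHomeomorph p) {s : X → Y} {G : Set X} (hG : IsOpen G)
    (hs : ContinuousOn s G) (hps : ∀ x ∈ G, p (s x) = x) : IsOpen (s '' G) := by
  rw [isOpen_iff_mem_nhds]
  rintro _ ⟨x, hx, rfl⟩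
  obtain ⟨q, hq, rfl⟩ := hp (s x)
  have h1 : s ⁻¹' q.source ∈ 𝓝 x :=
    (hs.continuousAt (hG.mem_nhds hx)).preimage_mem_nhds (q.open_source.mem_nhds hq)
  have h2 : q ⁻¹' (s ⁻¹' q.source ∩ G) ∈ 𝓝 (s x) := by
    refine hp.continuous.continuousAt.preimage_mem_nhds ?_
    rw [hps x hx]
    exact inter_mem h1 (hG.mem_nhds hx)
  filter_upwards [h2, q.open_source.mem_nhds hq] with y hy hyq
  refine ⟨q y, hy.2, q.injOn hy.1 hyq ?_⟩
  exact hps _ hy.2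

/-- A component of the preimage of a domain `U` meets the preimage of each regular value in `U`. -/
theorem IsClassK.exists_mem_component_of_regular (hf : IsClassK B f) {U : Set Sphere}
    (hU : IsOpen U) (hUc : IsPreconnected U) {V : Set Sphere}
    (hV : IsComponentOf V (Bᶜ ∩ f ⁻¹' U)) {w : Sphere} (hw : w ∈ U)
    (hwS : w ∉ singularValues B f) : ∃ y ∈ V, f y = w := by
  have hdense := hf.subset_closure_image hU hUc hV hw
  obtain ⟨z₀, hz₀, rfl⟩ := hV
  have hA := Sphere.isOpenEmbedding_param w
  have hO : IsOpen (U ∩ (singularValues B f)ᶜ) := hU.inter isClosed_closure.isOpen_compl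
  obtain ⟨ρ, hρ, hball⟩ := Metric.isOpen_iff.1 (hO.preimage hA.continuous) (Sphere.coord w w)
    (by rw [mem_preimage, Sphere.param_coord_self]; exact ⟨hw, hwS⟩)
  have hnhds : Sphere.param w '' Metric.ball (Sphere.coord w w) ρ ∈ 𝓝 w :=
    (hA.isOpenMap _ Metric.isOpen_ball).mem_nhds
      ⟨_, Metric.mem_ball_self hρ, Sphere.param_coord_self w⟩
  obtain ⟨_, ⟨ζ, hζ, hζv⟩, v, hv, rfl⟩ := mem_closure_iff_nhds.1 hdense _ hnhds
  have hvO := connectedComponentIn_subset _ _ hv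
  have hvY : v ∈ regularDomain B f := ⟨hvO.1, by
    rw [mem_preimage, ← hζv]
    exact (hball hζ).2⟩
  obtain ⟨s, hs, hsζ, hps⟩ := exists_section_of_convex hf hA.continuous
    (convex_ball (Sphere.coord w w) ρ) (fun x hx => (hball hx).2) hζ (y₀ := ⟨v, hvY⟩) hζv.symm
  refine ⟨s (Sphere.coord w w), ?_, ?_⟩
  -- The section over the disc has connected image in the preimage of `U` and passes through `v ∈
  -- V`, so it stays in `V`.
  · have hpre : IsPreconnected ((fun x => (s x : Sphere)) '' Metric.ball (Sphere.coord w w) ρ) :=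
      (convex_ball _ _).isPreconnected.image _ (continuous_subtype_val.comp_continuousOn hs)
    rw [connectedComponentIn_eq hv]
    refine hpre.subset_connectedComponentIn ⟨ζ, hζ, by simp only [hsζ]⟩ ?_
      ⟨_, Metric.mem_ball_self hρ, rfl⟩
    rintro _ ⟨x, hx, rfl⟩
    refine ⟨(s x).2.1, ?_⟩
    have h1 : f (s x) = Sphere.param w x := hps x hx
    rw [mem_preimage, h1]
    exact (hball hx).1
  · have h1 := hps _ (Metric.mem_ball_self hρ)
    rw [Sphere.param_coord_self] at h1
    exact h1

/-! ### Disconnecting the complement of the component -/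

/-- An open and a closed set with the same trace on `Vᶜ` make this trace clopen there, so components
cannot cross it. -/
theorem one_lt_connectivity {V O C : Set Sphere} (hO : IsOpen O) (hC : IsClosed C)
    (hOC : Vᶜ ∩ O = Vᶜ ∩ C) {a b : Sphere} (ha : a ∉ V) (hb : b ∉ V) (haO : a ∈ O) (hbO : b ∉ O) :
    1 < connectivity V := by
  suffices Nontrivial (ConnectedComponents (Vᶜ : Set Sphere)) from ENat.one_lt_card
  refine ⟨((⟨a, ha⟩ : (Vᶜ : Set Sphere)) : ConnectedComponents _),
    ((⟨b, hb⟩ : (Vᶜ : Set Sphere)) : ConnectedComponents _), fun h => hbO ?_⟩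
  have hclopen : IsClopen ((↑) ⁻¹' O : Set (Vᶜ : Set Sphere)) := by
    refine ⟨?_, hO.preimage continuous_subtype_val⟩
    have : ((↑) ⁻¹' O : Set (Vᶜ : Set Sphere)) = (↑) ⁻¹' C := by
      ext x
      have := Set.ext_iff.1 hOC x
      simpa [x.2] using this
    rw [this]
    exact hC.preimage continuous_subtype_val
  have h1 := ConnectedComponents.coe_eq_coe.1 h
  have h2 : (⟨b, hb⟩ : (Vᶜ : Set Sphere)) ∈ connectedComponent (⟨a, ha⟩ : (Vᶜ : Set Sphere)) := by
    rw [h1]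
    exact mem_connectedComponent
  exact hclopen.connectedComponent_subset haO h2

theorem mainTheorem11 (B : Set Sphere) (f : Sphere → Sphere) (hf : IsClassK B f)
    (U : Set Sphere) (hU : IsComponentOf U (fatouSet B f)) (hUm : IsMultiplyConnected U)
    (γ : Circle → Sphere) (hγc : Continuous γ) (hγi : Function.Injective γ)
    (hγU : Set.range γ ⊆ U)
    (Δ : Set Sphere) (hΔ : IsRegionBoundedBy Δ γ) (hΔB : Δ ∩ B = ∅)
    (hΔS : Δ ∩ singularValues B f = ∅) (hΔJ : (interior Δ ∩ juliaSet B f).Nonempty)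
    (V : Set Sphere) (hV : IsComponentOf V (Bᶜ ∩ f ⁻¹' U)) :
    IsMultiplyConnected V := by
  have hUo : IsOpen U := hUm.1
  have hUF : U ⊆ fatouSet B f := by
    obtain ⟨z, -, rfl⟩ := hU
    exact connectedComponentIn_subset _ _
  have hp := isLocalHomeomorph_regularMap hf
  obtain ⟨E, hE, hΔE⟩ := id hΔ
  have hγΔ : range γ ⊆ Δ := by
    obtain ⟨z, -, rfl⟩ := hE
    rw [hΔE]
    exact fun x hx hxE => connectedComponentIn_subset _ _ hxE hx
  have hγcl : IsClosed (range γ) := (isCompact_range hγc).isClosed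
  have hEo : IsOpen E := by
    obtain ⟨z, -, rfl⟩ := hE
    exact hγcl.isOpen_compl.connectedComponentIn
  have hΔcl : IsClosed Δ := hΔE ▸ hEo.isClosed_compl
  -- A component of the complement of the curve that meets `Δ` is not the exterior, so it lies in
  -- `Δ`.
  have hdiff : IsOpen (Δ \ range γ) := by
    rw [isOpen_iff_mem_nhds]
    rintro x ⟨hxΔ, hxγ⟩
    filter_upwards [(hγcl.isOpen_compl.connectedComponentIn (x := x)).mem_nhds
      (mem_connectedComponentIn hxγ)] with y hy
    refine ⟨?_, connectedComponentIn_subset _ _ hy⟩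
    obtain ⟨z, -, rfl⟩ := hE
    rw [hΔE] at hxΔ ⊢
    intro hyE
    refine hxΔ ?_
    rw [connectedComponentIn_eq hyE, ← connectedComponentIn_eq hy]
    exact mem_connectedComponentIn hxγ
  have hΔS' : ∀ x ∈ Δ, x ∉ singularValues B f := fun x hx hxS => by
    have : x ∈ (∅ : Set Sphere) := hΔS ▸ ⟨hx, hxS⟩
    exact this
  obtain ⟨y, hyV, hy⟩ := hf.exists_mem_component_of_regular hUo hUm.2.1.isPreconnected hV
    (hγU (mem_range_self 1)) (hΔS' _ (hγΔ (mem_range_self 1)))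
  obtain ⟨z₀, hz₀, rfl⟩ := hV
  set V : Set Sphere := connectedComponentIn (Bᶜ ∩ f ⁻¹' U) z₀ with hVdef
  have hVsub : V ⊆ Bᶜ ∩ f ⁻¹' U := connectedComponentIn_subset _ _
  have hVo : IsOpen V :=
    (isOpen_compl_inter_preimage hf.compact hf.meromorphic hUo).connectedComponentIn
  have hyY : y ∈ regularDomain B f := ⟨(hVsub hyV).1, by
    rw [mem_preimage, hy]
    exact hΔS' _ (hγΔ (mem_range_self 1))⟩
  obtain ⟨s, hs, hsy, hps⟩ := exists_section_of_region hf hγc hΔ hΔS ⟨y, hyY⟩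
    (show f y ∈ Δ by rw [hy]; exact hγΔ (mem_range_self 1))
  have hsy' : s (γ 1) = ⟨y, hyY⟩ := by
    rw [← hsy]
    exact congrArg s hy.symm
  set σ : Sphere → Sphere := fun x => s x with hσ
  have hσc : ContinuousOn σ Δ := continuous_subtype_val.comp_continuousOn hs
  have hfσ : ∀ x ∈ Δ, f (σ x) = x := hps
  have hσγ : σ '' range γ ⊆ V := by
    have hpre : IsPreconnected (σ '' range γ) :=
      (isConnected_range hγc).isPreconnected.image _ (hσc.mono hγΔ)
    rw [hVdef, connectedComponentIn_eq hyV]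
    refine hpre.subset_connectedComponentIn ⟨γ 1, mem_range_self _, by simp only [hσ, hsy']⟩ ?_
    rintro _ ⟨x, hx, rfl⟩
    refine ⟨(s x).2.1, ?_⟩
    rw [mem_preimage, hfσ x (hγΔ hx)]
    exact hγU hx
  have hOo : IsOpen (σ '' (Δ \ range γ)) := by
    have h1 := isOpen_image_of_section hp hdiff (hs.mono sdiff_subset) fun x hx => hps x hx.1
    have h2 := (isOpen_regularDomain hf).isOpenMap_subtype_val _ h1
    rwa [image_image] at h2
  have hCc : IsClosed (σ '' Δ) := (hΔcl.isCompact.image_of_continuousOn hσc).isClosed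
  obtain ⟨j, hjΔ, hjJ⟩ := hΔJ
  have hjU : j ∉ U := fun h => hjJ (hUF h)
  obtain ⟨b, hb⟩ := hf.nonempty
  refine ⟨hVo, isConnected_connectedComponentIn_iff.2 hz₀, ?_⟩
  refine one_lt_connectivity hOo hCc (a := σ j) (b := b) ?_ ?_ ?_ ?_ ?_
  -- Points of `σ(Δ)` outside `σ(Δ ∖ γ)` lie in `σ(γ) ⊆ V`, so on `Vᶜ` the open and the closed set
  -- coincide.
  · refine Subset.antisymm (inter_subset_inter_right _ (image_mono sdiff_subset)) ?_
    rintro _ ⟨hxV, x, hx, rfl⟩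
    exact ⟨hxV, x, ⟨hx, fun hxγ => hxV (hσγ ⟨x, hxγ, rfl⟩)⟩, rfl⟩
  · intro hjV
    have h1 := (hVsub hjV).2
    rw [mem_preimage, hfσ j (interior_subset hjΔ)] at h1
    exact hjU h1
  · exact fun hbV => (hVsub hbV).1 hb
  · exact ⟨j, ⟨interior_subset hjΔ, fun hjγ => hjU (hγU hjγ)⟩, rfl⟩
  · rintro ⟨x, -, hx⟩
    have h1 : σ x ∈ B := by rwa [hx]
    exact (s x).2.1 h1
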